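/- Let $p\ge 1$, $n\ge 1$, and let $f_1,\dots,f_n,g\in\mathbb C[x_1,\dots,x_p]$. Assume that every $f_j$ satisfies Mahler's Hypothesis: $f_j$ is non-constant, $f_j(x)\neq 0$ for all $x\in[0,\infty)^p$, and the top-degree homogeneous part of $f_j$ does not vanish at any $x\in[0,\infty)^p$ with $x\ne 0$. Assume moreover that $f_1,\dots,f_n$ all have the same degree. For a polynomial $f$ without zeros in $[0,\infty)^p$ and a branch of $\log f$ that is continuous on $[0,\infty)^p$, put $$\zeta(s;f,g)=\sum_{k_1=0}^\infty\cdots\sum_{k_p=0}^\infty g(k_1,\dots,k_p)\,f(k_1,\dots,k_p)^{-s},\qquad f(k)^{-s}:=e^{-s\log f(k)},\qquad \operatorname{Re}(s)\gg 0.$$ Then for $f=f_1,\dots,f_n$ and for $f=\prod_{j=1}^n f_j$ such a branch exists, and for every such branch the series converges absolutely for $\operatorname{Re}(s)$ sufficiently large and $\zeta(s;f,g)$ extends to a meromorphic function on $\mathbb C$ that is regular at $s=0$. The values $\zeta(0;f,g)$ of these continuations at $s=0$ satisfy, for any choice of the branches, $$\zeta\Bigl(0;\prod_{j=1}^n f_j,\,g\Bigr)=\frac1n\sum_{j=1}^n\zeta(0;f_j,g).$$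 -/

import Mathlib

open scoped BigOperators

/-- The closed octant `[0,∞)^p`. -/
def octant (p : ℕ) : Set (Fin p → ℝ) := {x | ∀ i, 0 ≤ x i}

/-- The value of a complex polynomial in `p` variables at a real point. -/
noncomputable def evalReal {p : ℕ} (f : MvPolynomial (Fin p) ℂ) (x : Fin p → ℝ) : ℂ :=
  MvPolynomial.eval (fun i => (x i : ℂ)) f

/-- The top-degree homogeneous part of `f`. -/
noncomputable def topPart {p : ℕ} (f : MvPolynomial (Fin p) ℂ) : MvPolynomial (Fin p) ℂ :=
  MvPolynomial.homogeneousComponent f.totalDegree f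

/-- Mahler's Hypothesis: `f` is non-constant, has no zero in the closed octant, and its
top-degree homogeneous part has no zero there other than the origin. -/
structure MahlerHypothesis {p : ℕ} (f : MvPolynomial (Fin p) ℂ) : Prop where
  nonconstant : 0 < f.totalDegree
  ne_zero : ∀ x ∈ octant p, evalReal f x ≠ 0
  top_ne_zero : ∀ x ∈ octant p, x ≠ 0 → evalReal (topPart f) x ≠ 0

/-- `ℓ` is a branch of `log f` that is continuous on the closed octant. -/
structure IsLogBranch {p : ℕ} (f : MvPolynomial (Fin p) ℂ) (ℓ : (Fin p → ℝ) → ℂ) : Prop where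
  continuousOn : ContinuousOn ℓ (octant p)
  exp_eq : ∀ x ∈ octant p, Complex.exp (ℓ x) = evalReal f x

/-- The term `g(k) f(k)^{-s}` of the Dirichlet series, where `ℓ` is the chosen branch of
`log f`. -/
noncomputable def zetaTerm {p : ℕ} (g : MvPolynomial (Fin p) ℂ) (ℓ : (Fin p → ℝ) → ℂ)
    (s : ℂ) (k : Fin p → ℕ) : ℂ :=
  evalReal g (fun i => (k i : ℝ)) * Complex.exp (-s * ℓ (fun i => (k i : ℝ)))

/-- `Z` is a meromorphic function on `ℂ` which, for `Re s` large, is the sum of the (absolutely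
convergent) series `ζ(s; f, g) = ∑ g(k) f(k)^{-s}` over `k ∈ {0,1,2,…}^p`, the powers being
formed with the branch `ℓ` of `log f`. -/
structure IsZetaContinuation {p : ℕ} (g : MvPolynomial (Fin p) ℂ) (ℓ : (Fin p → ℝ) → ℂ)
    (Z : ℂ → ℂ) : Prop where
  meromorphicOn : MeromorphicOn Z Set.univ
  hasSum : ∃ σ : ℝ, ∀ s : ℂ, σ < s.re → HasSum (zetaTerm g ℓ s) (Z s)

/-- `log f` has a continuous branch on the octant, and for each such branch `ζ(s; f, g)` has a
meromorphic continuation to `ℂ` that is regular at `s₀`. -/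
def ZetaRegularAt {p : ℕ} (f g : MvPolynomial (Fin p) ℂ) (s₀ : ℂ) : Prop :=
  (∃ ℓ, IsLogBranch f ℓ) ∧
    ∀ ℓ, IsLogBranch f ℓ → ∃ Z, IsZetaContinuation g ℓ Z ∧ AnalyticAt ℂ Z s₀

/-- `v` is the value at `s₀` of a meromorphic continuation, regular at `s₀`, of `ζ(s; f, g)`,
formed with some continuous branch of `log f`. -/
def IsZetaValue {p : ℕ} (f g : MvPolynomial (Fin p) ℂ) (s₀ v : ℂ) : Prop :=
  ∃ (ℓ : (Fin p → ℝ) → ℂ) (Z : ℂ → ℂ),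
    IsLogBranch f ℓ ∧ IsZetaContinuation g ℓ Z ∧ AnalyticAt ℂ Z s₀ ∧ Z s₀ = v

/-! All powers are put into one family: for `a` in `ℂⁿ` with `∑ aⱼ = 1`, let `Z_a(s)` continue `∑ₖ
g(k) exp(-s ∑ⱼ aⱼ ℓⱼ(k))`. The point is that `Z_a(0)` is a linear form `∑ cⱼ aⱼ`. Unit vectors give
`ζ(0; fⱼ, g) = cⱼ`, and `a = (1/n, …, 1/n)` gives the product with `s` replaced by `n s`, which
fixes `s = 0` (`exists_isZetaContinuation_prod`).

Continuation comes from telescoping. For an amplitude `A` of order `ω`, the unit differences of `xᵢ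
A ∏ⱼ exp(-bⱼ ℓⱼ)` in direction `i` sum to zero. Their first Taylor terms add up to a divergence,
which by Euler's identity is `(ω + p - d ∑ bⱼ) A` plus order `ω - 1`, times the exponential. The
common degree `d` makes this factor depend on `b = s a` only through `d s`. Thus a sum of order `ω`
reduces to one of order `ω - 1` and a remainder, divided by `-(ω + p - d s)` (`exists_recurrence`).
At `s = 0` the factor vanishes only for `ω = -p`, so the pole there is at most simple, and `s Z(s)`
has a limit independent of `a`.

Linearity holds because differentiating a polynomial gives a polynomial, while differentiating the
exponential produces a factor `bⱼ`. The `b`-free terms therefore stay polynomials and have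
disappeared once the order is negative, before any division by zero is possible except in terms with
a factor `bⱼ = s aⱼ`. That factor cancels the simple pole and leaves a constant times `aⱼ`
(`exists_hasContinuation_pure_of_neg`). Constants collected on the way are linear too, since `∑ aⱼ =
1`. -/

/-! ### Polynomials on the octant: derivatives, homogeneity, ellipticity. -/

open MvPolynomial in
theorem hasDerivAt_evalReal_comp {p : ℕ} (h : MvPolynomial (Fin p) ℂ) {γ : ℝ → Fin p → ℝ}
    {γ' : Fin p → ℝ} {t : ℝ} (hγ : ∀ i, HasDerivAt (fun t => γ t i) (γ' i) t) :
    HasDerivAt (fun t => evalReal h (γ t))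
      (∑ i, (γ' i : ℂ) * evalReal (pderiv i h) (γ t)) t := by
  induction h using MvPolynomial.induction_on with
  | C a => simpa [evalReal] using hasDerivAt_const t a
  | add f g hf hg =>
    have := hf.add hg
    simp only [evalReal, map_add, mul_add, Finset.sum_add_distrib] at this ⊢
    exact this
  | mul_X f j hf =>
    have := hf.mul (hγ j).ofReal_comp
    simp only [evalReal, Derivation.leibniz, map_add, map_mul, eval_X, pderiv_X, smul_eq_mul]
      at this ⊢
    refine this.congr_deriv ?_
    simp only [mul_add, Finset.sum_add_distrib, Finset.sum_mul, Pi.single_apply]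
    rw [add_comm]
    congr 1
    · rw [Finset.sum_eq_single j] <;> simp +contextual [mul_comm, eq_comm]
    · exact Finset.sum_congr rfl fun i _ => by ring

theorem hasDerivAt_evalReal_update {p : ℕ} (h : MvPolynomial (Fin p) ℂ) (x : Fin p → ℝ)
    (i : Fin p) :
    HasDerivAt (fun t => evalReal h (Function.update x i t))
      (evalReal (MvPolynomial.pderiv i h) x) (x i) := by
  have := hasDerivAt_evalReal_comp h (γ := fun t => Function.update x i t)
    (γ' := Pi.single i 1) (t := x i) (fun j => by
      rcases eq_or_ne j i with rfl | hj
      · simpa using hasDerivAt_id' (x j)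
      · simpa [hj] using hasDerivAt_const (x i) (x j))
  simpa [Pi.single_apply, apply_ite, ite_mul] using this

theorem hasDerivAt_evalReal_smul {p : ℕ} (h : MvPolynomial (Fin p) ℂ) (x : Fin p → ℝ) (t : ℝ) :
    HasDerivAt (fun t : ℝ => evalReal h (t • x))
      (∑ i, (x i : ℂ) * evalReal (MvPolynomial.pderiv i h) (t • x)) t :=
  hasDerivAt_evalReal_comp h fun i => by simpa using (hasDerivAt_id t).mul_const (x i)

theorem continuous_evalReal {p : ℕ} (h : MvPolynomial (Fin p) ℂ) : Continuous (evalReal h) := by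
  have := MvPolynomial.continuous_eval h
  exact this.comp (by fun_prop)

theorem evalReal_isHomogeneous_smul {p : ℕ} {h : MvPolynomial (Fin p) ℂ} {N : ℕ}
    (hh : h.IsHomogeneous N) (t : ℝ) (x : Fin p → ℝ) :
    evalReal h (t • x) = (t : ℂ) ^ N * evalReal h x := by
  rw [evalReal, evalReal, MvPolynomial.eval_eq', MvPolynomial.eval_eq', Finset.mul_sum]
  refine Finset.sum_congr rfl fun e he => ?_
  have : ∑ i, e i = N := by
    have := hh (MvPolynomial.mem_support_iff.mp he)
    simpa [Finsupp.weight_apply, Finsupp.sum_fintype] using this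
  simp only [Pi.smul_apply, smul_eq_mul, Complex.ofReal_mul, mul_pow, Finset.prod_mul_distrib,
    Finset.prod_pow_eq_pow_sum, this]
  ring

theorem exists_norm_evalReal_le {p : ℕ} (h : MvPolynomial (Fin p) ℂ) {N : ℕ}
    (hN : h.totalDegree ≤ N) :
    ∃ C : ℝ, 0 ≤ C ∧ ∀ x : Fin p → ℝ, ‖evalReal h x‖ ≤ C * (1 + ‖x‖) ^ N := by
  refine ⟨∑ e ∈ h.support, ‖h.coeff e‖, Finset.sum_nonneg fun _ _ => norm_nonneg _, fun x => ?_⟩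
  rw [evalReal, MvPolynomial.eval_eq', Finset.sum_mul]
  refine norm_sum_le_of_le _ fun e he => ?_
  rw [norm_mul, norm_prod]
  gcongr
  calc ∏ i, ‖(x i : ℂ) ^ e i‖ ≤ ∏ i, (1 + ‖x‖) ^ e i := by
        refine Finset.prod_le_prod (fun _ _ => norm_nonneg _) fun i _ => ?_
        rw [norm_pow, Complex.norm_real]
        gcongr
        linarith [norm_le_pi_norm x i]
    _ = (1 + ‖x‖) ^ ∑ i, e i := Finset.prod_pow_eq_pow_sum ..
    _ ≤ _ := by
        refine pow_le_pow_right₀ (by linarith [norm_nonneg x]) (le_trans ?_ hN)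
        simpa [Finsupp.sum_fintype] using MvPolynomial.le_totalDegree he

theorem mem_octant_smul {p : ℕ} {x : Fin p → ℝ} (hx : x ∈ octant p) {t : ℝ} (ht : 0 ≤ t) :
    t • x ∈ octant p := fun i => by simpa using mul_nonneg ht (hx i)

theorem isClosed_octant (p : ℕ) : IsClosed (octant p) := by
  simp only [octant, Set.ofPred_forall]
  exact isClosed_iInter fun i => isClosed_le continuous_const (continuous_apply i)

theorem convex_octant (p : ℕ) : Convex ℝ (octant p) := by
  intro x hx y hy a b ha hb _ i
  have := hx i
  have := hy i
  simp only [Pi.add_apply, Pi.smul_apply, smul_eq_mul]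
  positivity

theorem zero_mem_octant (p : ℕ) : (0 : Fin p → ℝ) ∈ octant p := fun _ => le_rfl

/-- Homogenizing `f` with an extra variable `t` gives a continuous function on the compact slice `t
≥ 0`, `‖y‖ = 1 - t`. It has no zero there: at `t = 0` it is the top part, and for `t > 0` a rescaled
value of `f`. The minimum of its modulus is the constant. -/
theorem MahlerHypothesis.exists_le_norm {p : ℕ} {f : MvPolynomial (Fin p) ℂ}
    (hf : MahlerHypothesis f) :
    ∃ c : ℝ, 0 < c ∧ ∀ x ∈ octant p, c * (1 + ‖x‖) ^ f.totalDegree ≤ ‖evalReal f x‖ := by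
  set d := f.totalDegree with hd
  set φ : ℝ × (Fin p → ℝ) → ℂ := fun q =>
    ∑ m ∈ Finset.range (d + 1), (q.1 : ℂ) ^ (d - m) *
      evalReal (MvPolynomial.homogeneousComponent m f) q.2 with hφ
  have hφc : Continuous φ := by
    refine continuous_finsetSum _ fun m _ => ?_
    exact ((Complex.continuous_ofReal.comp continuous_fst).pow _).mul
      ((continuous_evalReal _).comp continuous_snd)
  have hφs : ∀ (t : ℝ) (x : Fin p → ℝ), φ (t, t • x) = (t : ℂ) ^ d * evalReal f x := by
    intro t x
    have h1 : evalReal f x = ∑ m ∈ Finset.range (d + 1),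
        evalReal (MvPolynomial.homogeneousComponent m f) x := by
      conv_lhs => rw [← MvPolynomial.sum_homogeneousComponent f]
      simp [evalReal, hd]
    rw [h1, Finset.mul_sum]
    refine Finset.sum_congr rfl fun m hm => ?_
    rw [evalReal_isHomogeneous_smul (MvPolynomial.homogeneousComponent_isHomogeneous m f),
      ← mul_assoc, ← pow_add, Nat.sub_add_cancel (Nat.lt_succ_iff.mp (Finset.mem_range.mp hm))]
  set K : Set (ℝ × (Fin p → ℝ)) :=
    {q | 0 ≤ q.1 ∧ q.2 ∈ octant p ∧ ‖q.2‖ = 1 - q.1} with hK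
  have hKc : IsCompact K := by
    refine ((isCompact_Icc (a := (0 : ℝ)) (b := 1)).prod
      (isCompact_closedBall (0 : Fin p → ℝ) 1)).of_isClosed_subset ?_ ?_
    · refine (isClosed_le continuous_const continuous_fst).inter
        (((isClosed_octant p).preimage continuous_snd).inter (isClosed_eq ?_ ?_)) <;> fun_prop
    · rintro ⟨t, y⟩ ⟨h1, -, h3⟩
      simp only at h1 h3
      have := norm_nonneg y
      simp only [Set.mem_prod, Set.mem_Icc, Metric.mem_closedBall, dist_zero_right]
      exact ⟨⟨h1, by linarith⟩, by linarith⟩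
  have hne : ∀ q ∈ K, φ q ≠ 0 := by
    rintro ⟨t, y⟩ ⟨h1, h2, h3⟩
    simp only at h1 h2 h3
    rcases h1.eq_or_lt with rfl | ht
    · have : φ (0, y) = evalReal (topPart f) y := by
        simp only [hφ]
        rw [Finset.sum_eq_single d]
        · simp [topPart, hd]
        · intro m hm hmd
          have : d - m ≠ 0 := by have := Finset.mem_range.mp hm; omega
          simp [this]
        · simp
      rw [this]
      refine hf.top_ne_zero y h2 ?_
      rintro rfl
      simp at h3
    · have := hφs t (t⁻¹ • y)
      rw [smul_smul, mul_inv_cancel₀ ht.ne', one_smul] at this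
      rw [this]
      exact mul_ne_zero (pow_ne_zero _ (by exact_mod_cast ht.ne'))
        (hf.ne_zero _ (mem_octant_smul h2 (by positivity)))
  have hKne : K.Nonempty := ⟨(1, 0), by simp [hK, zero_mem_octant]⟩
  obtain ⟨q, hq, hmin⟩ := hKc.exists_isMinOn hKne hφc.norm.continuousOn
  refine ⟨‖φ q‖, norm_pos_iff.mpr (hne q hq), fun x hx => ?_⟩
  have hx0 := norm_nonneg x
  set t : ℝ := (1 + ‖x‖)⁻¹ with ht
  have htpos : 0 < t := by positivity
  have hmem : (t, t • x) ∈ K := by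
    refine ⟨htpos.le, mem_octant_smul hx htpos.le, ?_⟩
    simp only [norm_smul, Real.norm_eq_abs, abs_of_pos htpos]
    rw [ht]; field_simp; ring
  have := hmin hmem
  simp only [Set.mem_ofPred_eq, hφs, norm_mul, norm_pow, Complex.norm_real, Real.norm_eq_abs,
    abs_of_pos htpos] at this
  calc ‖φ q‖ * (1 + ‖x‖) ^ d ≤ t ^ d * ‖evalReal f x‖ * (1 + ‖x‖) ^ d := by gcongr
    _ = ‖evalReal f x‖ := by
      rw [ht, inv_pow]; field_simp

/-- By Euler's identity the part of degree `m` is multiplied by `m - N`, so the part of degree `N`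
drops out. -/
theorem totalDegree_sum_X_mul_pderiv_sub_le {p : ℕ} (f : MvPolynomial (Fin p) ℂ) {N : ℕ}
    (hN : f.totalDegree ≤ N) :
    (∑ i, MvPolynomial.X i * MvPolynomial.pderiv i f - (N : ℂ) • f).totalDegree ≤ N - 1 := by
  have h1 : f = ∑ m ∈ Finset.range (N + 1), MvPolynomial.homogeneousComponent m f := by
    conv_lhs => rw [← MvPolynomial.sum_homogeneousComponent f]
    refine Finset.sum_subset (by simpa using hN) fun m _ hm => ?_
    exact MvPolynomial.homogeneousComponent_eq_zero _ _ (by simpa using hm)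
  have h2 : ∑ i, MvPolynomial.X i * MvPolynomial.pderiv i f - (N : ℂ) • f =
      ∑ m ∈ Finset.range (N + 1), ((m : ℂ) - N) • MvPolynomial.homogeneousComponent m f := by
    conv_lhs => rw [h1]
    simp only [map_sum, Finset.mul_sum]
    rw [Finset.sum_comm, Finset.smul_sum, ← Finset.sum_sub_distrib]
    refine Finset.sum_congr rfl fun m _ => ?_
    rw [(MvPolynomial.homogeneousComponent_isHomogeneous m f).sum_X_mul_pderiv, sub_smul,
      Nat.cast_smul_eq_nsmul, Nat.cast_smul_eq_nsmul]
  rw [h2]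
  refine MvPolynomial.totalDegree_finsetSum_le fun m hm => ?_
  rcases eq_or_ne m N with rfl | hmN
  · simp
  · refine (MvPolynomial.totalDegree_smul_le _ _).trans
      ((MvPolynomial.homogeneousComponent_isHomogeneous m f).totalDegree_le.trans ?_)
    have := Finset.mem_range.mp hm
    omega

theorem totalDegree_pderiv_le {p : ℕ} (f : MvPolynomial (Fin p) ℂ) (i : Fin p) :
    (MvPolynomial.pderiv i f).totalDegree ≤ f.totalDegree - 1 := by
  conv_lhs => rw [← MvPolynomial.sum_homogeneousComponent f, map_sum]
  refine MvPolynomial.totalDegree_finsetSum_le fun m hm => ?_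
  refine (MvPolynomial.homogeneousComponent_isHomogeneous m f).pderiv.totalDegree_le.trans ?_
  have := Finset.mem_range.mp hm
  omega

/-! ### Continuous branches of the logarithm and their growth. -/

open Filter Topology in
-- Near `t₀` the imaginary part of `l t - l t₀` is below `π` in modulus, so this difference is the
-- principal logarithm of `φ t / φ t₀`.
theorem hasDerivWithinAt_of_exp_eq {l φ : ℝ → ℂ} {φ' : ℂ} {s : Set ℝ} {t₀ : ℝ} (ht₀ : t₀ ∈ s)
    (hl : ContinuousWithinAt l s t₀) (hexp : ∀ t ∈ s, Complex.exp (l t) = φ t)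
    (hφ : HasDerivWithinAt φ φ' s t₀) : HasDerivWithinAt l (φ' / φ t₀) s t₀ := by
  have hne : φ t₀ ≠ 0 := by rw [← hexp t₀ ht₀]; exact Complex.exp_ne_zero _
  have h1 : HasDerivWithinAt (fun t => l t₀ + Complex.log (φ t / φ t₀)) (φ' / φ t₀) s t₀ := by
    have := ((hφ.div_const (φ t₀)).clog_real (by simp [div_self hne])).const_add (l t₀)
    simpa [div_self hne] using this
  refine h1.congr_of_eventuallyEq ?_ (by simp [div_self hne])
  have h2 : Tendsto (fun t => (l t - l t₀).im) (𝓝[s] t₀) (𝓝 0) := by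
    have : Tendsto (fun t => l t - l t₀) (𝓝[s] t₀) (𝓝 0) := by
      simpa using (hl.tendsto.sub_const (l t₀))
    exact (Complex.continuous_im.tendsto' 0 0 Complex.zero_im).comp this
  have h3 := h2 (Ioo_mem_nhds (neg_lt_zero.mpr Real.pi_pos) Real.pi_pos)
  filter_upwards [h3, self_mem_nhdsWithin] with t ht hts
  rw [← hexp t hts, ← hexp t₀ ht₀, ← Complex.exp_sub, Complex.log_exp ht.1 ht.2.le]
  ring

theorem exists_isLogBranch {p : ℕ} {f : MvPolynomial (Fin p) ℂ}
    (hf : ∀ x ∈ octant p, evalReal f x ≠ 0) : ∃ ℓ, IsLogBranch f ℓ := by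
  -- A retraction onto the octant turns `f` into a zero-free function on the simply connected space
  -- `ℝᵖ`, where a logarithm exists.
  set r : (Fin p → ℝ) → Fin p → ℝ := fun x i => max (x i) 0 with hr
  have hrc : Continuous r := by fun_prop
  have hro : ∀ x, r x ∈ octant p := fun x i => le_max_right _ _
  have hrx : ∀ x ∈ octant p, r x = x := fun x hx => funext fun i => max_eq_left (hx i)
  have hsc : IsSimplyConnected (Set.univ : Set (Fin p → ℝ)) := by
    have := (convex_univ (𝕜 := ℝ) (E := Fin p → ℝ)).contractibleSpace Set.univ_nonempty
    exact SimplyConnectedSpace.ofContractible _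
  obtain ⟨ℓ, hc, he⟩ := Complex.exists_continuousOn_eqOn_exp_comp
    (X := Fin p → ℝ) (U := Set.univ) (g := fun x => evalReal f (r x))
    hsc    isOpen_univ ((continuous_evalReal f).comp hrc).continuousOn
    (by rintro ⟨x, -, hx⟩; exact hf _ (hro x) hx)
  refine ⟨ℓ, hc.mono (Set.subset_univ _), fun x hx => ?_⟩
  have := he (Set.mem_univ x)
  simpa [hrx x hx] using this

theorem exists_int_of_isLogBranch {p : ℕ} {f : MvPolynomial (Fin p) ℂ}
    {ℓ ℓ' : (Fin p → ℝ) → ℂ} (h : IsLogBranch f ℓ) (h' : IsLogBranch f ℓ') :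
    ∃ m : ℤ, ∀ x ∈ octant p, ℓ' x = ℓ x + m * (2 * Real.pi * Complex.I) := by
  have h1 : ∀ x ∈ octant p, ∃ m : ℤ, ℓ' x = ℓ x + m * (2 * Real.pi * Complex.I) := fun x hx =>
    Complex.exp_eq_exp_iff_exists_int.mp ((h'.exp_eq x hx).trans (h.exp_eq x hx).symm)
  have hpi := Real.pi_pos
  choose! m hm using h1
  set D : (Fin p → ℝ) → ℝ := fun x => (ℓ' x - ℓ x).im / (2 * Real.pi) with hD
  have hDm : ∀ x ∈ octant p, D x = m x := by
    intro x hx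
    rw [hD]
    simp only [hm x hx, add_sub_cancel_left]
    simp
  have hDc : ContinuousOn D (octant p) :=
    (Complex.continuous_im.comp_continuousOn (h'.continuousOn.sub h.continuousOn)).div_const _
  have hpre : (D '' octant p).OrdConnected :=
    ((convex_octant p).isPreconnected.image D hDc).ordConnected
  have key : ∀ x ∈ octant p, ∀ y ∈ octant p, m x ≤ m y := by
    intro x hx y hy
    by_contra hlt
    push Not at hlt
    -- If `m` took two values, the continuous `D` would attain a half-integer.
    have h2 : (m y : ℝ) + 1 / 2 ∈ D '' octant p := by
      refine hpre.out ⟨y, hy, rfl⟩ ⟨x, hx, rfl⟩ ⟨?_, ?_⟩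
      · rw [hDm y hy]; linarith
      · rw [hDm x hx]
        have : ((m y + 1 : ℤ) : ℝ) ≤ m x := by exact_mod_cast hlt
        push_cast at this
        linarith
    obtain ⟨z, hz, hzy⟩ := h2
    rw [hDm z hz] at hzy
    have : (2 * m z : ℤ) = 2 * m y + 1 := by
      have : (2 * m z : ℝ) = 2 * m y + 1 := by linarith
      exact_mod_cast this
    omega
  refine ⟨m 0, fun x hx => ?_⟩
  rw [hm x hx, le_antisymm (key x hx 0 (zero_mem_octant p)) (key 0 (zero_mem_octant p) x hx)]

/-- Along a ray `t • y` with `‖y‖ = 1`, the leading parts of the two derivatives cancel by Euler's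
identity and leave `O((1 + t)⁻²)`, uniformly in `y`; this is integrable. The argument of `f` is
bounded along with the modulus, as complex exponents require. -/
theorem MahlerHypothesis.exists_norm_log_sub_le {p : ℕ} {f : MvPolynomial (Fin p) ℂ}
    (hf : MahlerHypothesis f) {ℓ : (Fin p → ℝ) → ℂ} (hℓ : IsLogBranch f ℓ) :
    ∃ C : ℝ, ∀ x ∈ octant p, ‖ℓ x - f.totalDegree * Real.log (1 + ‖x‖)‖ ≤ C := by
  set d := f.totalDegree with hd
  have hdpos : 0 < d := hf.nonconstant
  obtain ⟨c, hc, hlow⟩ := hf.exists_le_norm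
  obtain ⟨C₁, hC₁, hb₁⟩ := exists_norm_evalReal_le _
    (totalDegree_sum_X_mul_pderiv_sub_le f le_rfl)
  have hb₂ : ∀ i : Fin p, ∃ C : ℝ, 0 ≤ C ∧ ∀ x : Fin p → ℝ,
      ‖evalReal (MvPolynomial.pderiv i f) x‖ ≤ C * (1 + ‖x‖) ^ (d - 1) :=
    fun i => exists_norm_evalReal_le _ (totalDegree_pderiv_le f i)
  choose C₂ hC₂ hb₂ using hb₂
  set M := (C₁ + ∑ i, C₂ i) / c with hM
  have hM0 : 0 ≤ M := div_nonneg (add_nonneg hC₁ (Finset.sum_nonneg fun i _ => hC₂ i)) hc.le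
  have key : ∀ y ∈ octant p, ‖y‖ = 1 → ∀ T : ℝ, 0 ≤ T →
      ‖ℓ (T • y) - d * Real.log (1 + T)‖ ≤ ‖ℓ 0‖ + M := by
    intro y hy hy1 T hT
    have hlogc : ∀ t : ℝ, 0 ≤ t → HasDerivAt (fun t : ℝ => (d : ℂ) * (Real.log (1 + t) : ℂ))
        (d * ((1 / (1 + t) : ℝ) : ℂ)) t := by
      intro t ht
      have h1 : HasDerivAt (fun t : ℝ => Real.log (1 + t)) (1 / (1 + t)) t :=
        ((hasDerivAt_id' t).const_add 1).log (by linarith)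
      exact h1.ofReal_comp.const_mul (d : ℂ)
    have hcont : ContinuousOn (fun t : ℝ => ℓ (t • y)) (Set.Ici 0) :=
      hℓ.continuousOn.comp (by fun_prop) fun t ht => mem_octant_smul hy ht
    have hder : ∀ t : ℝ, 0 ≤ t → HasDerivWithinAt (fun t : ℝ => ℓ (t • y))
        ((∑ i, (y i : ℂ) * evalReal (MvPolynomial.pderiv i f) (t • y)) / evalReal f (t • y))
        (Set.Ici 0) t := fun t ht =>
      hasDerivWithinAt_of_exp_eq (φ := fun t => evalReal f (t • y)) ht (hcont t ht)
        (fun u hu => hℓ.exp_eq _ (mem_octant_smul hy hu))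
        (hasDerivAt_evalReal_smul f y t).hasDerivWithinAt
    have hbound : ∀ t : ℝ, 0 ≤ t →
        ‖(∑ i, (y i : ℂ) * evalReal (MvPolynomial.pderiv i f) (t • y)) / evalReal f (t • y)
          - d * ((1 / (1 + t) : ℝ) : ℂ)‖ ≤ M / (1 + t) ^ 2 := by
      intro t ht
      have hty : ‖t • y‖ = t := by rw [norm_smul, hy1, mul_one, Real.norm_eq_abs, abs_of_nonneg ht]
      have hf0 := hf.ne_zero _ (mem_octant_smul hy ht)
      have ht1 : (1 + t : ℂ) ≠ 0 := by
        have : (1 + t : ℝ) ≠ 0 := by linarith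
        exact_mod_cast this
      have hnum : (∑ i, (y i : ℂ) * evalReal (MvPolynomial.pderiv i f) (t • y)) /
          evalReal f (t • y) - d * ((1 / (1 + t) : ℝ) : ℂ) =
          (evalReal (∑ i, MvPolynomial.X i * MvPolynomial.pderiv i f - (d : ℂ) • f) (t • y) +
            ∑ i, (y i : ℂ) * evalReal (MvPolynomial.pderiv i f) (t • y)) /
          (evalReal f (t • y) * (1 + t)) := by
        have : evalReal (∑ i, MvPolynomial.X i * MvPolynomial.pderiv i f - (d : ℂ) • f) (t • y) =
            t * (∑ i, (y i : ℂ) * evalReal (MvPolynomial.pderiv i f) (t • y)) -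
              d * evalReal f (t • y) := by
          simp [evalReal, Finset.mul_sum, mul_assoc]
        rw [this]
        push_cast
        field_simp
        ring
      rw [hnum, norm_div, norm_mul]
      have hl := hlow _ (mem_octant_smul hy ht)
      rw [hty] at hl
      have hn : ‖evalReal (∑ i, MvPolynomial.X i * MvPolynomial.pderiv i f - (d : ℂ) • f) (t • y) +
            ∑ i, (y i : ℂ) * evalReal (MvPolynomial.pderiv i f) (t • y)‖ ≤
          (C₁ + ∑ i, C₂ i) * (1 + t) ^ (d - 1) := by
        rw [add_mul, Finset.sum_mul]
        refine norm_add_le_of_le ?_ (norm_sum_le_of_le _ fun i _ => ?_)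
        · simpa only [hty] using hb₁ (t • y)
        · rw [norm_mul, Complex.norm_real]
          have h1 := hb₂ i (t • y)
          rw [hty] at h1
          have h2 := norm_le_pi_norm y i
          rw [hy1] at h2
          calc _ ≤ 1 * (C₂ i * (1 + t) ^ (d - 1)) :=
                mul_le_mul h2 h1 (norm_nonneg _) zero_le_one
            _ = _ := one_mul _
      have ht1' : ‖(1 + t : ℂ)‖ = 1 + t := by
        have : ‖((1 + t : ℝ) : ℂ)‖ = 1 + t := by
          rw [Complex.norm_real, Real.norm_eq_abs, abs_of_nonneg (by linarith)]
        simpa using this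
      have hp : (1 + t) ^ d = (1 + t) ^ (d - 1) * (1 + t) := by
        rw [← pow_succ, Nat.sub_add_cancel hdpos]
      have ht1p : 0 < 1 + t := by linarith
      rw [ht1']
      calc _ ≤ ((C₁ + ∑ i, C₂ i) * (1 + t) ^ (d - 1)) / (c * (1 + t) ^ d * (1 + t)) := by
            have := Finset.sum_nonneg fun i (_ : i ∈ Finset.univ) => hC₂ i
            gcongr
        _ = M / (1 + t) ^ 2 := by
            rw [hp, hM]
            field_simp
    -- The comparison function is `‖ℓ 0‖` plus the integral of `M / (1 + u) ^ 2` over `[0, t]`.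
    have hB : ∀ t ∈ Set.Icc (0 : ℝ) T, HasDerivAt (fun t : ℝ => ‖ℓ 0‖ + (M - M * (1 + t)⁻¹))
        (M / (1 + t) ^ 2) t := by
      intro t ht
      have h1 : HasDerivAt (fun t : ℝ => (1 + t)⁻¹) (-1 / (1 + t) ^ 2) t :=
        ((hasDerivAt_id' t).const_add 1).inv (by linarith [ht.1])
      refine (((h1.const_mul M).const_sub M).const_add _).congr_deriv ?_
      ring
    have := image_norm_le_of_norm_deriv_right_le_deriv_boundary'
      (f := fun t : ℝ => ℓ (t • y) - d * Real.log (1 + t)) (a := 0) (b := T)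
      (B := fun t : ℝ => ‖ℓ 0‖ + (M - M * (1 + t)⁻¹)) (B' := fun t => M / (1 + t) ^ 2)
      (f' := fun t => (∑ i, (y i : ℂ) * evalReal (MvPolynomial.pderiv i f) (t • y)) /
        evalReal f (t • y) - d * ((1 / (1 + t) : ℝ) : ℂ))
      (fun t ht => ((hcont t ht.1).mono Set.Icc_subset_Ici_self).sub
        (hlogc t ht.1).continuousAt.continuousWithinAt)
      (fun t ht => ((hder t ht.1).mono (Set.Ici_subset_Ici.mpr ht.1)).sub
        (hlogc t ht.1).hasDerivWithinAt)
      (by simp)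
      (fun t ht => (hB t ht).continuousAt.continuousWithinAt)
      (fun t ht => (hB t (Set.Ico_subset_Icc_self ht)).hasDerivWithinAt)
      (fun t ht => hbound t ht.1) (Set.right_mem_Icc.mpr hT)
    refine this.trans ?_
    have : 0 ≤ M * (1 + T)⁻¹ := by positivity
    linarith
  refine ⟨‖ℓ 0‖ + M, fun x hx => ?_⟩
  rcases eq_or_ne x 0 with rfl | hx0
  · simpa using hM0
  · have hn : 0 < ‖x‖ := norm_pos_iff.mpr hx0
    have := key (‖x‖⁻¹ • x) (mem_octant_smul hx (by positivity))
      (by rw [norm_smul, norm_inv, norm_norm, inv_mul_cancel₀ hn.ne']) ‖x‖ hn.le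
    rwa [smul_smul, mul_inv_cancel₀ hn.ne', one_smul] at this

/-! ### Symbol calculus: amplitudes, their orders and derivatives. -/

/-- Functions `ℓ₁, …, ℓₙ` on the octant that grow like `d log ‖x‖`, with partial derivatives
`G j i / F`, where `F` is a polynomial of degree `D` and elliptic on the octant. -/
structure LogSystem (p n : ℕ) where
  d : ℕ
  D : ℕ
  F : MvPolynomial (Fin p) ℂ
  G : Fin n → Fin p → MvPolynomial (Fin p) ℂ
  ℓ : Fin n → (Fin p → ℝ) → ℂ
  d_pos : 0 < d
  D_pos : 0 < D
  totalDegree_F : F.totalDegree ≤ D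
  totalDegree_G : ∀ j i, (G j i).totalDegree ≤ D - 1
  -- This encodes that the radial derivative `∑ xᵢ ∂ᵢ ℓⱼ` is `d + O(1/‖x‖)`, with the same `d` for
  -- all `j`.
  totalDegree_euler : ∀ j,
    (∑ i, MvPolynomial.X i * G j i - (d : ℂ) • F).totalDegree ≤ D - 1
  exists_le_norm_F : ∃ c : ℝ, 0 < c ∧ ∀ x ∈ octant p, c * (1 + ‖x‖) ^ D ≤ ‖evalReal F x‖
  exists_norm_sub_le : ∃ C : ℝ, ∀ j, ∀ x ∈ octant p, ‖ℓ j x - d * Real.log (1 + ‖x‖)‖ ≤ C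
  hasDerivWithinAt : ∀ j i, ∀ x ∈ octant p,
    HasDerivWithinAt (fun t => ℓ j (Function.update x i t)) (evalReal (G j i) x / evalReal F x)
      (Set.Ici 0) (x i)

/-- Amplitudes of order at most `ω`: combinations of quotients `h / F ^ m` with coefficients that
are polynomials in the parameters `b`. With `pure = true`, the terms that do not depend on
`b` have to be polynomials in `x`. -/
inductive Amp {p n : ℕ} (F : MvPolynomial (Fin p) ℂ) (D : ℕ) :
    Bool → ℤ → ((Fin n → ℂ) → (Fin p → ℝ) → ℂ) → Prop
  | zero {pure : Bool} {ω : ℤ} : Amp F D pure ω (fun _ _ => 0)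
  | quot {pure : Bool} {ω : ℤ} (h : MvPolynomial (Fin p) ℂ) (k m : ℕ) (hh : h.IsHomogeneous k)
      (hm : pure = true → m = 0) (hk : (k : ℤ) ≤ ω + D * m) :
      Amp F D pure ω (fun _ x => evalReal h x / evalReal F x ^ m)
  | add {pure : Bool} {ω : ℤ} {A B : (Fin n → ℂ) → (Fin p → ℝ) → ℂ} (hA : Amp F D pure ω A)
      (hB : Amp F D pure ω B) : Amp F D pure ω (fun b x => A b x + B b x)
  | smul {pure : Bool} {ω : ℤ} {A : (Fin n → ℂ) → (Fin p → ℝ) → ℂ} (c : ℂ)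
      (hA : Amp F D pure ω A) : Amp F D pure ω (fun b x => c * A b x)
  | mulVar {pure : Bool} {ω : ℤ} {A : (Fin n → ℂ) → (Fin p → ℝ) → ℂ} (j : Fin n)
      (hA : Amp F D false ω A) : Amp F D pure ω (fun b x => b j * A b x)

namespace Amp

variable {p n : ℕ} {F : MvPolynomial (Fin p) ℂ} {D : ℕ} {pure : Bool} {ω : ℤ}
  {A B : (Fin n → ℂ) → (Fin p → ℝ) → ℂ}

theorem mono_order {ω' : ℤ} (hA : Amp F D pure ω A) (h : ω ≤ ω') : Amp F D pure ω' A := by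
  induction hA with
  | zero => exact .zero
  | quot q k m hq hm hk => exact .quot q k m hq hm (by linarith)
  | add _ _ h1 h2 => exact (h1 h).add (h2 h)
  | smul c _ h1 => exact (h1 h).smul c
  | mulVar j _ h1 => exact .mulVar j (h1 h)

theorem sum {ι : Type*} {s : Finset ι} {A : ι → (Fin n → ℂ) → (Fin p → ℝ) → ℂ}
    (hA : ∀ i ∈ s, Amp F D pure ω (A i)) : Amp F D pure ω (fun b x => ∑ i ∈ s, A i b x) := by
  classical
  induction s using Finset.induction_on with
  | empty => simpa using Amp.zero
  | insert i s hi ih =>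
    simp only [Finset.sum_insert hi]
    exact (hA i (by simp)).add (ih fun j hj => hA j (by simp [hj]))

theorem sub (hA : Amp F D pure ω A) (hB : Amp F D pure ω B) :
    Amp F D pure ω (fun b x => A b x - B b x) := by
  simpa [sub_eq_add_neg] using hA.add (hB.smul (-1))

theorem of_totalDegree_le {h : MvPolynomial (Fin p) ℂ} {N : ℕ} (hN : h.totalDegree ≤ N) (m : ℕ)
    (hm : pure = true → m = 0) (hk : (N : ℤ) ≤ ω + D * m) :
    Amp (n := n) F D pure ω (fun _ x => evalReal h x / evalReal F x ^ m) := by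
  have h1 : ∀ x, evalReal h x = ∑ k ∈ Finset.range (h.totalDegree + 1),
      evalReal (MvPolynomial.homogeneousComponent k h) x := fun x => by
    conv_lhs => rw [← MvPolynomial.sum_homogeneousComponent h]
    simp [evalReal]
  simp only [h1, Finset.sum_div]
  refine Amp.sum fun k hk' => .quot _ k m
    (MvPolynomial.homogeneousComponent_isHomogeneous k h) hm ?_
  have := Finset.mem_range.mp hk'
  omega

theorem mulPoly {H : MvPolynomial (Fin p) ℂ} {δ : ℕ} (hH : H.totalDegree ≤ δ)
    (hA : Amp F D pure ω A) : Amp F D pure (ω + δ) (fun b x => evalReal H x * A b x) := by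
  induction hA with
  | zero => simpa using Amp.zero
  | @quot pure ω q k m hq hm hk =>
    have := of_totalDegree_le (n := n) (F := F) (D := D) (ω := ω + δ) (h := H * q) (N := δ + k)
      ((MvPolynomial.totalDegree_mul _ _).trans (add_le_add hH hq.totalDegree_le)) m hm
      (by push_cast; linarith)
    simpa [evalReal, mul_div_assoc] using this
  | add _ _ h1 h2 => simpa only [mul_add] using h1.add h2
  | smul c _ h1 => simpa only [mul_left_comm] using h1.smul c
  | mulVar j _ h1 => simpa only [mul_left_comm] using h1.mulVar j

/-- The extra denominator costs purity, so the result returns to a pure amplitude only under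
`mulVar`. This suffices for derivatives of the exponential, which carry a factor `bⱼ`. -/
theorem mulQuot {H : MvPolynomial (Fin p) ℂ} (hD : 0 < D) (hH : H.totalDegree ≤ D - 1)
    (hA : Amp F D pure ω A) :
    Amp F D false (ω - 1) (fun b x => evalReal H x / evalReal F x * A b x) := by
  induction hA with
  | zero => simpa using Amp.zero
  | @quot pure ω q k m hq hm hk =>
    have := of_totalDegree_le (n := n) (F := F) (D := D) (ω := ω - 1) (pure := false)
      (h := H * q) (N := D - 1 + k)
      ((MvPolynomial.totalDegree_mul _ _).trans (add_le_add hH hq.totalDegree_le)) (m + 1)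
      (by simp) (by push_cast [Nat.cast_sub (Nat.one_le_iff_ne_zero.mpr hD.ne')]; linarith)
    simpa [evalReal, div_mul_div_comm, pow_succ'] using this
  | add _ _ h1 h2 => simpa only [mul_add] using h1.add h2
  | smul c _ h1 => simpa only [mul_left_comm] using h1.smul c
  | mulVar j _ h1 => simpa only [mul_left_comm] using h1.mulVar j

theorem differentiable (hA : Amp F D pure ω A) (a : Fin n → ℂ) (x : Fin p → ℝ) :
    Differentiable ℂ (fun s : ℂ => A (s • a) x) := by
  induction hA with
  | zero => fun_prop
  | quot q k m hq hm hk => fun_prop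
  | add _ _ h1 h2 => exact h1.add h2
  | smul c _ h1 => exact h1.const_mul c
  | mulVar j _ h1 => exact (differentiable_id.mul_const (a j)).mul h1

theorem exists_norm_le (hF : ∃ c : ℝ, 0 < c ∧ ∀ x ∈ octant p, c * (1 + ‖x‖) ^ D ≤ ‖evalReal F x‖)
    (hA : Amp F D pure ω A) (S : ℝ) :
    ∃ C : ℝ, 0 ≤ C ∧ ∀ b : Fin n → ℂ, ‖b‖ ≤ S → ∀ x ∈ octant p,
      ‖A b x‖ ≤ C * (1 + ‖x‖) ^ (ω : ℝ) := by
  induction hA with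
  | zero => exact ⟨0, le_rfl, by simp⟩
  | @quot pure ω q k m hq hm hk =>
    obtain ⟨c, hc, hF⟩ := hF
    obtain ⟨C, hC, hq'⟩ := exists_norm_evalReal_le q hq.totalDegree_le
    refine ⟨C / c ^ m, by positivity, fun b _ x hx => ?_⟩
    have hx0 : 0 < 1 + ‖x‖ := by positivity
    rw [norm_div, norm_pow]
    calc _ ≤ C * (1 + ‖x‖) ^ k / (c * (1 + ‖x‖) ^ D) ^ m := by
          gcongr
          · exact hq' x
          · exact hF x hx
      _ = C / c ^ m * (1 + ‖x‖) ^ ((k : ℝ) - (D * m : ℕ)) := by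
          rw [Real.rpow_sub hx0, Real.rpow_natCast, Real.rpow_natCast, mul_pow, ← pow_mul]
          field_simp
      _ ≤ _ := by
          gcongr
          · linarith [norm_nonneg x]
          · have : (k : ℤ) - (D * m : ℕ) ≤ ω := by push_cast; linarith
            exact_mod_cast this
  | add _ _ h1 h2 =>
    obtain ⟨C₁, h₁, h1⟩ := h1
    obtain ⟨C₂, h₂, h2⟩ := h2
    refine ⟨C₁ + C₂, by positivity, fun b hb x hx => ?_⟩
    rw [add_mul]
    exact norm_add_le_of_le (h1 b hb x hx) (h2 b hb x hx)
  | smul c _ h1 =>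
    obtain ⟨C₁, h₁, h1⟩ := h1
    refine ⟨‖c‖ * C₁, by positivity, fun b hb x hx => ?_⟩
    rw [norm_mul, mul_assoc]
    gcongr
    exact h1 b hb x hx
  | mulVar j _ h1 =>
    obtain ⟨C₁, h₁, h1⟩ := h1
    refine ⟨|S| * C₁, by positivity, fun b hb x hx => ?_⟩
    rw [norm_mul, mul_assoc]
    gcongr
    · exact (norm_le_pi_norm b j).trans (hb.trans (le_abs_self S))
    · exact h1 b hb x hx

/-- Differentiation lowers the order by one, and the Euler field acts as multiplication by `ω` up to
lower order. Purity survives: a pure quotient has `m = 0`, so the term with `∂ᵢF` is absent. -/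
theorem exists_deriv (hD : 0 < D) (hFD : F.totalDegree ≤ D)
    (hF : ∀ x ∈ octant p, evalReal F x ≠ 0) (hA : Amp F D pure ω A) :
    ∃ (A' : Fin p → (Fin n → ℂ) → (Fin p → ℝ) → ℂ) (V : (Fin n → ℂ) → (Fin p → ℝ) → ℂ),
      (∀ i, Amp F D pure (ω - 1) (A' i)) ∧ Amp F D pure (ω - 1) V ∧
      (∀ i b, ∀ x ∈ octant p, HasDerivWithinAt (fun t => A b (Function.update x i t)) (A' i b x)
        (Set.Ici 0) (x i)) ∧
      ∀ b, ∀ x ∈ octant p, ∑ i, (x i : ℂ) * A' i b x = ω * A b x + V b x := by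
  induction hA with
  | zero =>
    exact ⟨fun _ _ _ => 0, fun _ _ => 0, fun _ => .zero, .zero,
      fun i b x _ => hasDerivWithinAt_const _ _ _, by simp⟩
  | @quot pure ω q k m hq hm hk =>
    have hD1 : ((D - 1 : ℕ) : ℤ) = D - 1 := by omega
    have hquot : ∀ H : MvPolynomial (Fin p) ℂ, H.totalDegree ≤ D - 1 →
        Amp (n := n) F D pure (ω - 1)
          (fun _ x => m * (evalReal H x / evalReal F x * (evalReal q x / evalReal F x ^ m))) := by
      intro H hH
      rcases Nat.eq_zero_or_pos m with rfl | hmpos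
      · simpa using Amp.zero
      · have hp : pure = false := by
          by_contra h
          exact hmpos.ne' (hm (by simpa using h))
        subst hp
        exact (mulQuot hD hH (.quot q k m hq hm hk)).smul m
    set R := ∑ i, MvPolynomial.X i * MvPolynomial.pderiv i F - (D : ℂ) • F with hR
    refine ⟨fun i _ x => evalReal (MvPolynomial.pderiv i q) x / evalReal F x ^ m -
        m * (evalReal (MvPolynomial.pderiv i F) x / evalReal F x *
          (evalReal q x / evalReal F x ^ m)),
      fun _ x => ((k : ℂ) - D * m - ω) * (evalReal q x / evalReal F x ^ m) -
        m * (evalReal R x / evalReal F x * (evalReal q x / evalReal F x ^ m)), ?_, ?_, ?_, ?_⟩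
    · refine fun i => sub ?_ (hquot _ ((totalDegree_pderiv_le F i).trans (by omega)))
      rcases Nat.eq_zero_or_pos k with rfl | hkpos
      · have : q.totalDegree = 0 := Nat.le_zero.mp hq.totalDegree_le
        rw [MvPolynomial.totalDegree_eq_zero_iff_eq_C] at this
        rw [this]
        simpa [evalReal] using Amp.zero
      · exact .quot _ (k - 1) m hq.pderiv hm (by omega)
    · refine sub ?_ (hquot _ (totalDegree_sum_X_mul_pderiv_sub_le F hFD))
      -- Either the quotient has exact order `ω` and its coefficient vanishes, or it already has
      -- order at most `ω - 1`. This uses that numerators are homogeneous.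
      rcases (show (k : ℤ) - D * m ≤ ω by linarith).eq_or_lt with h | h
      · have : (k : ℂ) - D * m - ω = 0 := by
          rw [← h]; push_cast; ring
        simpa [this] using Amp.zero
      · exact smul _ (.quot q k m hq hm (by linarith))
    · intro i b x hx
      have h0 := hF x hx
      have h1 := hasDerivAt_evalReal_update q x i
      have h2 := (hasDerivAt_evalReal_update F x i).pow m
      have h3 := h1.div h2 (by simpa using pow_ne_zero m h0)
      simp only [Function.update_eq_self] at h3
      refine (h3.congr_deriv ?_).hasDerivWithinAt
      rcases m with _ | m
      · simp
      · simp only [Pi.pow_apply, Function.update_eq_self, Nat.add_sub_cancel]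
        field_simp
        ring
    · intro b x hx
      have h0 := hF x hx
      have h1 : ∑ i, (x i : ℂ) * evalReal (MvPolynomial.pderiv i q) x = k * evalReal q x := by
        have := congrArg (fun h => evalReal h x) hq.sum_X_mul_pderiv
        simpa [evalReal] using this
      have h2 : evalReal R x = ∑ i, (x i : ℂ) * evalReal (MvPolynomial.pderiv i F) x -
          D * evalReal F x := by
        simp [hR, evalReal]
      have h3 : ∑ i, (x i : ℂ) * (evalReal (MvPolynomial.pderiv i q) x / evalReal F x ^ m -
          m * (evalReal (MvPolynomial.pderiv i F) x / evalReal F x *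
          (evalReal q x / evalReal F x ^ m))) =
          (∑ i, (x i : ℂ) * evalReal (MvPolynomial.pderiv i q) x) / evalReal F x ^ m -
          m * ((∑ i, (x i : ℂ) * evalReal (MvPolynomial.pderiv i F) x) / evalReal F x *
          (evalReal q x / evalReal F x ^ m)) := by
        rw [Finset.sum_div, Finset.sum_div, Finset.sum_mul, Finset.mul_sum,
          ← Finset.sum_sub_distrib]
        exact Finset.sum_congr rfl fun i _ => by ring
      beta_reduce
      rw [h3, h1, h2]
      field_simp
      ring
  | add _ _ h1 h2 =>
    obtain ⟨A₁, V₁, a1, b1, c1, d1⟩ := h1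
    obtain ⟨A₂, V₂, a2, b2, c2, d2⟩ := h2
    refine ⟨_, _, fun i => (a1 i).add (a2 i), b1.add b2,
      fun i b x hx => (c1 i b x hx).add (c2 i b x hx), fun b x hx => ?_⟩
    simp only [mul_add, Finset.sum_add_distrib, d1 b x hx, d2 b x hx]
    ring
  | smul c _ h1 =>
    obtain ⟨A₁, V₁, a1, b1, c1, d1⟩ := h1
    refine ⟨_, _, fun i => (a1 i).smul c, b1.smul c,
      fun i b x hx => (c1 i b x hx).const_mul c, fun b x hx => ?_⟩
    simp only [mul_left_comm _ c, ← Finset.mul_sum, d1 b x hx, mul_add]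
  | mulVar j _ h1 =>
    obtain ⟨A₁, V₁, a1, b1, c1, d1⟩ := h1
    refine ⟨_, _, fun i => (a1 i).mulVar j, b1.mulVar j,
      fun i b x hx => (c1 i b x hx).const_mul (b j), fun b x hx => ?_⟩
    simp only [mul_left_comm _ (b j), ← Finset.mul_sum, d1 b x hx, mul_add]

end Amp

namespace LogSystem

variable {p n : ℕ} (L : LogSystem p n) {pure : Bool} {ω : ℤ}
  {A : (Fin n → ℂ) → (Fin p → ℝ) → ℂ}

/-- The function `∏ⱼ exp(-bⱼ ℓⱼ(x))`. -/
noncomputable def power (b : Fin n → ℂ) (x : Fin p → ℝ) : ℂ :=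
  Complex.exp (-∑ j, b j * L.ℓ j x)

theorem evalReal_F_ne_zero {x : Fin p → ℝ} (hx : x ∈ octant p) : evalReal L.F x ≠ 0 := by
  obtain ⟨c, hc, h⟩ := L.exists_le_norm_F
  have : 0 < c * (1 + ‖x‖) ^ L.D := by positivity
  exact norm_pos_iff.mp (this.trans_le (h x hx))

theorem hasDerivWithinAt_power (b : Fin n → ℂ) (i : Fin p) {x : Fin p → ℝ} (hx : x ∈ octant p) :
    HasDerivWithinAt (fun t => L.power b (Function.update x i t))
      (L.power b x * -∑ j, b j * (evalReal (L.G j i) x / evalReal L.F x)) (Set.Ici 0) (x i) := by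
  have h1 : HasDerivWithinAt (fun t => -∑ j, b j * L.ℓ j (Function.update x i t))
      (-∑ j, b j * (evalReal (L.G j i) x / evalReal L.F x)) (Set.Ici 0) (x i) :=
    (HasDerivWithinAt.fun_sum fun j _ => (L.hasDerivWithinAt j i x hx).const_mul (b j)).neg
  simpa [power] using h1.cexp

theorem exists_hasDerivWithinAt_mul_power (hA : Amp L.F L.D pure ω A) (i : Fin p) :
    ∃ A' : (Fin n → ℂ) → (Fin p → ℝ) → ℂ, Amp L.F L.D pure (ω - 1) A' ∧
      ∀ b, ∀ x ∈ octant p, HasDerivWithinAt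
        (fun t => A b (Function.update x i t) * L.power b (Function.update x i t))
        (A' b x * L.power b x) (Set.Ici 0) (x i) := by
  obtain ⟨A', V, h1, -, h3, -⟩ :=
    hA.exists_deriv L.D_pos L.totalDegree_F fun x hx => L.evalReal_F_ne_zero hx
  refine ⟨fun b x => A' i b x -
    ∑ j, b j * (evalReal (L.G j i) x / evalReal L.F x * A b x), (h1 i).sub (.sum fun j _ =>
      .mulVar j (.mulQuot L.D_pos (L.totalDegree_G j i) hA)), fun b x hx => ?_⟩
  refine ((h3 i b x hx).mul (L.hasDerivWithinAt_power b i hx)).congr_deriv ?_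
  simp only [Function.update_eq_self, ← mul_assoc, ← Finset.sum_mul]
  ring

/-- In the divergence of `x A ∏ exp(-bⱼ ℓⱼ)` the coordinates contribute `p`, the amplitude `ω`, and
each exponential `-d bⱼ`. The errors coming from the exponentials carry `bⱼ`, so purity is kept. -/
theorem exists_euler (hA : Amp L.F L.D pure ω A) :
    ∃ (B : Fin p → (Fin n → ℂ) → (Fin p → ℝ) → ℂ) (V : (Fin n → ℂ) → (Fin p → ℝ) → ℂ),
      (∀ i, Amp L.F L.D pure ω (B i)) ∧ Amp L.F L.D pure (ω - 1) V ∧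
      (∀ i b, ∀ x ∈ octant p, HasDerivWithinAt
        (fun t => evalReal (MvPolynomial.X i) (Function.update x i t) *
          A b (Function.update x i t) * L.power b (Function.update x i t))
        (B i b x * L.power b x) (Set.Ici 0) (x i)) ∧
      ∀ b, ∀ x ∈ octant p, ∑ i, B i b x = (ω + p - L.d * ∑ j, b j) * A b x + V b x := by
  obtain ⟨A', V, h1, h2, h3, h4⟩ :=
    hA.exists_deriv L.D_pos L.totalDegree_F fun x hx => L.evalReal_F_ne_zero hx
  set R : Fin n → MvPolynomial (Fin p) ℂ := fun j =>
    ∑ i, MvPolynomial.X i * L.G j i - (L.d : ℂ) • L.F with hR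
  have hX : ∀ i : Fin p, (MvPolynomial.X (R := ℂ) i).totalDegree ≤ 1 := fun i => by
    simp [MvPolynomial.totalDegree_X]
  refine ⟨fun i b x => A b x + evalReal (MvPolynomial.X i) x * A' i b x -
      ∑ j, b j * (evalReal (MvPolynomial.X i) x *
        (evalReal (L.G j i) x / evalReal L.F x * A b x)),
    fun b x => V b x - ∑ j, b j * (evalReal (R j) x / evalReal L.F x * A b x), ?_, ?_, ?_, ?_⟩
  · intro i
    refine (hA.add ?_).sub (.sum fun j _ => .mulVar j ?_)
    · simpa using (h1 i).mulPoly (hX i)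
    · simpa using (Amp.mulQuot L.D_pos (L.totalDegree_G j i) hA).mulPoly (hX i)
  · exact h2.sub (.sum fun j _ => .mulVar j (.mulQuot L.D_pos (L.totalDegree_euler j) hA))
  · intro i b x hx
    have h5 := (((hasDerivAt_evalReal_update (MvPolynomial.X i) x i).hasDerivWithinAt
      (s := Set.Ici 0)).mul (h3 i b x hx)).mul (L.hasDerivWithinAt_power b i hx)
    refine h5.congr_deriv ?_
    have h6 : ∑ j, b j * (evalReal (MvPolynomial.X i) x *
        (evalReal (L.G j i) x / evalReal L.F x * A b x)) = evalReal (MvPolynomial.X i) x *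
        A b x * ∑ j, b j * (evalReal (L.G j i) x / evalReal L.F x) := by
      rw [Finset.mul_sum]
      exact Finset.sum_congr rfl fun j _ => by ring
    have h7 : evalReal (MvPolynomial.pderiv i (MvPolynomial.X i)) x = 1 := by simp [evalReal]
    simp only [Function.update_eq_self, Pi.mul_apply, h6, h7]
    ring
  · intro b x hx
    have h0 := L.evalReal_F_ne_zero hx
    have h5 : ∀ j, evalReal (R j) x =
        ∑ i, (x i : ℂ) * evalReal (L.G j i) x - L.d * evalReal L.F x := fun j => by
      simp [hR, evalReal]
    have h6 : ∀ i, evalReal (MvPolynomial.X i) x = (x i : ℂ) := fun i => by simp [evalReal]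
    simp only [h6, Finset.sum_sub_distrib, Finset.sum_add_distrib, h4 b x hx, Finset.sum_const,
      Finset.card_univ, Fintype.card_fin, nsmul_eq_mul]
    rw [Finset.sum_comm]
    have h7 : ∀ j, b j * (evalReal (R j) x / evalReal L.F x * A b x) =
        ∑ i, b j * (x i * (evalReal (L.G j i) x / evalReal L.F x * A b x)) -
          L.d * b j * A b x := fun j => by
      rw [h5, ← Finset.mul_sum]
      simp only [← mul_assoc, ← Finset.sum_mul, mul_div_assoc', ← Finset.sum_div]
      field_simp
    simp only [h7, Finset.sum_sub_distrib, ← Finset.sum_mul, ← Finset.mul_sum]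
    ring

end LogSystem

/-! ### Lattice sums: summability, telescoping and Taylor expansion. -/

/-- The point of the octant with natural coordinates `k`. -/
def natPoint {p : ℕ} (k : Fin p → ℕ) : Fin p → ℝ := fun i => (k i : ℝ)

theorem natPoint_mem_octant {p : ℕ} (k : Fin p → ℕ) : natPoint k ∈ octant p :=
  fun _ => Nat.cast_nonneg _

theorem natPoint_add_single {p : ℕ} (k : Fin p → ℕ) (i : Fin p) :
    natPoint (k + Pi.single i 1) = Function.update (natPoint k) i (natPoint k i + 1) := by
  ext j
  rcases eq_or_ne j i with rfl | hj
  · simp [natPoint]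
  · simp [natPoint, hj]

/-- The sup norm dominates every coordinate, so the term is at most the product of the `(1 + kᵢ) ^
(r / p)`, with `r / p < -1`. -/
theorem summable_one_add_norm_natPoint_rpow {p : ℕ} {r : ℝ} (hr : r < -p) :
    Summable fun k : Fin p → ℕ => (1 + ‖natPoint k‖) ^ r := by
  rcases Nat.eq_zero_or_pos p with rfl | hp
  · exact .of_finite
  have hp' : (0 : ℝ) < p := by exact_mod_cast hp
  have hrp : r / p < -1 := by rw [div_lt_iff₀ hp']; linarith
  have h1 : Summable fun m : ℕ => (1 + (m : ℝ)) ^ (r / p) := by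
    have := (summable_nat_add_iff 1).mpr (Real.summable_nat_rpow.mpr hrp)
    simpa [add_comm] using this
  refine summable_of_sum_le (c := (∑' m : ℕ, (1 + (m : ℝ)) ^ (r / p)) ^ p)
    (fun k => by positivity) fun s => ?_
  have hle : ∀ k : Fin p → ℕ, (1 + ‖natPoint k‖) ^ r ≤ ∏ i, (1 + (k i : ℝ)) ^ (r / p) := by
    intro k
    have h0 : (0 : ℝ) < 1 + ‖natPoint k‖ := by positivity
    calc (1 + ‖natPoint k‖) ^ r = ∏ _i : Fin p, (1 + ‖natPoint k‖) ^ (r / p) := by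
          rw [Finset.prod_const, Finset.card_univ, Fintype.card_fin, ← Real.rpow_natCast,
            ← Real.rpow_mul h0.le, div_mul_cancel₀ _ hp'.ne']
      _ ≤ _ := by
          refine Finset.prod_le_prod (fun _ _ => by positivity) fun i _ => ?_
          refine Real.rpow_le_rpow_of_nonpos (by positivity) ?_ (by linarith)
          have := norm_le_pi_norm (natPoint k) i
          simp only [natPoint, Real.norm_natCast] at this ⊢
          linarith
  set M := s.sup (fun k => Finset.univ.sup k) + 1 with hM
  have hs : s ⊆ Fintype.piFinset fun _ : Fin p => Finset.range M := by
    intro k hk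
    refine Fintype.mem_piFinset.mpr fun i => Finset.mem_range.mpr (Nat.lt_succ_of_le ?_)
    exact (Finset.le_sup (f := k) (Finset.mem_univ i)).trans
      (Finset.le_sup (f := fun k : Fin p → ℕ => Finset.univ.sup k) hk)
  calc ∑ k ∈ s, (1 + ‖natPoint k‖) ^ r
      ≤ ∑ k ∈ s, ∏ i, (1 + (k i : ℝ)) ^ (r / p) := Finset.sum_le_sum fun k _ => hle k
    _ ≤ ∑ k ∈ Fintype.piFinset fun _ : Fin p => Finset.range M,
        ∏ i, (1 + (k i : ℝ)) ^ (r / p) :=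
        Finset.sum_le_sum_of_subset_of_nonneg hs fun k _ _ => by positivity
    _ = ∏ _i : Fin p, ∑ m ∈ Finset.range M, (1 + (m : ℝ)) ^ (r / p) :=
        (Finset.prod_univ_sum (fun _ : Fin p => Finset.range M)
          fun _ m => (1 + (m : ℝ)) ^ (r / p)).symm
    _ ≤ ∏ _i : Fin p, ∑' m : ℕ, (1 + (m : ℝ)) ^ (r / p) :=
        Finset.prod_le_prod (fun _ _ => by positivity) fun _ _ =>
          h1.sum_le_tsum _ fun _ _ => by positivity
    _ = _ := by simp

/-- The shifted sum misses only the face `kᵢ = 0`, where `ψ` vanishes. -/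
theorem hasSum_sub_shift_eq_zero {p : ℕ} {ψ : (Fin p → ℕ) → ℂ} (hψ : Summable ψ) (i : Fin p)
    (h0 : ∀ k, k i = 0 → ψ k = 0) :
    HasSum (fun k : Fin p → ℕ => ψ (k + Pi.single i 1) - ψ k) 0 := by
  have h1 : HasSum (fun k : Fin p → ℕ => ψ (k + Pi.single i 1)) (∑' k, ψ k) := by
    refine (Function.Injective.hasSum_iff (g := fun k : Fin p → ℕ => k + Pi.single i 1)
      (add_left_injective (Pi.single i 1)) fun k hk => h0 k ?_).mpr hψ.hasSum
    by_contra hki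
    refine hk ⟨k - Pi.single i 1, ?_⟩
    ext j
    rcases eq_or_ne j i with rfl | hj
    · simp; omega
    · simp [hj]
  simpa using h1.sub hψ.hasSum

/-- On an interval of length one the mean value inequality passes the bound `C` through each
induction step; the factorial gain is not needed. -/
theorem norm_sub_taylor_sum_le {a C : ℝ} (N : ℕ) : ∀ (φ : ℕ → ℝ → ℂ),
    (∀ j < N, ∀ t ∈ Set.Icc a (a + 1), HasDerivWithinAt (φ j) (φ (j + 1) t) (Set.Icc a (a + 1)) t) →
    (∀ t ∈ Set.Icc a (a + 1), ‖φ N t‖ ≤ C) → ∀ t ∈ Set.Icc a (a + 1),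
      ‖φ 0 t - ∑ j ∈ Finset.range N, φ j a * ((t - a : ℝ) : ℂ) ^ j / j.factorial‖ ≤ C := by
  induction N with
  | zero => intro φ _ hC t ht; simpa using hC t ht
  | succ N ih =>
    intro φ hφ hC t ht
    have ha : a ∈ Set.Icc a (a + 1) := ⟨le_rfl, by linarith⟩
    have h1 := ih (fun j => φ (j + 1)) (fun j hj => hφ (j + 1) (by omega)) hC
    have hC0 : 0 ≤ C := (norm_nonneg _).trans (hC a ha)
    have hder : ∀ u ∈ Set.Icc a (a + 1), HasDerivWithinAt
        (fun u => φ 0 u - ∑ j ∈ Finset.range (N + 1), φ j a * ((u - a : ℝ) : ℂ) ^ j / j.factorial)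
        (φ 1 u - ∑ j ∈ Finset.range N, φ (j + 1) a * ((u - a : ℝ) : ℂ) ^ j / j.factorial)
        (Set.Icc a (a + 1)) u := by
      intro u hu
      refine (hφ 0 (by omega) u hu).sub ?_
      have h2 : HasDerivAt (fun u : ℝ => ((u - a : ℝ) : ℂ)) 1 u := by
        simpa using ((hasDerivAt_id' u).sub_const a).ofReal_comp
      have h3 : ∀ j : ℕ, HasDerivAt
          (fun u : ℝ => φ (j + 1) a * ((u - a : ℝ) : ℂ) ^ (j + 1) / (j + 1).factorial)
          (φ (j + 1) a * ((u - a : ℝ) : ℂ) ^ j / j.factorial) u := by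
        intro j
        refine (((h2.fun_pow (j + 1)).const_mul (φ (j + 1) a)).div_const _).congr_deriv ?_
        have : (j.factorial : ℂ) ≠ 0 := by exact_mod_cast j.factorial_ne_zero
        have : (j + 1 : ℂ) ≠ 0 := by exact_mod_cast j.succ_ne_zero
        rw [Nat.factorial_succ]
        push_cast
        field_simp
      simp only [Finset.sum_range_succ']
      have h4 := HasDerivAt.fun_sum (u := Finset.range N) fun j _ => h3 j
      simpa using (h4.add_const (φ 0 a * ((0 : ℕ).factorial : ℂ)⁻¹)).hasDerivWithinAt
    have h5 := (convex_Icc a (a + 1)).norm_image_sub_le_of_norm_hasDerivWithin_le hder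
      (fun u hu => h1 u hu) ha ht
    have h6 : φ 0 a - ∑ j ∈ Finset.range (N + 1),
        φ j a * ((a - a : ℝ) : ℂ) ^ j / j.factorial = 0 := by
      rw [Finset.sum_range_succ']
      simp
    rw [h6, sub_zero] at h5
    refine h5.trans ?_
    rw [Real.norm_eq_abs, abs_of_nonneg (by linarith [ht.1])]
    nlinarith [ht.2]

theorem rpow_le_two_rpow_mul {u v : ℝ} (hu : 0 < u) (huv : u ≤ v) (hv : v ≤ 2 * u) (ρ : ℝ) :
    v ^ ρ ≤ 2 ^ |ρ| * u ^ ρ := by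
  rcases le_total 0 ρ with h | h
  · rw [abs_of_nonneg h, ← Real.mul_rpow (by norm_num) hu.le]
    exact Real.rpow_le_rpow (hu.le.trans huv) hv h
  · refine (Real.rpow_le_rpow_of_nonpos hu huv h).trans
      (le_mul_of_one_le_left (by positivity) (Real.one_le_rpow (by norm_num) (abs_nonneg _)))

theorem update_mem_octant {p : ℕ} {x : Fin p → ℝ} (hx : x ∈ octant p) (i : Fin p) {t : ℝ}
    (ht : 0 ≤ t) : Function.update x i t ∈ octant p := by
  intro j
  rcases eq_or_ne j i with rfl | hj
  · simpa using ht
  · simpa [hj] using hx j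

theorem norm_le_norm_update {p : ℕ} {x : Fin p → ℝ} (hx : x ∈ octant p) (i : Fin p) {t : ℝ}
    (ht : t ∈ Set.Icc (x i) (x i + 1)) : ‖x‖ ≤ ‖Function.update x i t‖ ∧
      ‖Function.update x i t‖ ≤ ‖x‖ + 1 := by
  have h0 := hx i
  constructor
  · refine (pi_norm_le_iff_of_nonneg (norm_nonneg _)).mpr fun j => ?_
    refine le_trans ?_ (norm_le_pi_norm _ j)
    rcases eq_or_ne j i with rfl | hj
    · simp only [Function.update_self, Real.norm_eq_abs]
      exact abs_le_abs_of_nonneg h0 ht.1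
    · simp [hj]
  · refine (pi_norm_le_iff_of_nonneg (by positivity)).mpr fun j => ?_
    rcases eq_or_ne j i with rfl | hj
    · have := norm_le_pi_norm x j
      rw [Real.norm_eq_abs, abs_of_nonneg h0] at this
      simp only [Function.update_self, Real.norm_eq_abs, abs_of_nonneg (h0.trans ht.1)]
      linarith [ht.2]
    · have := norm_le_pi_norm x j
      simp only [hj, ne_eq, not_false_eq_true, Function.update_of_ne]
      linarith

namespace LogSystem

variable {p n : ℕ} (L : LogSystem p n) {pure : Bool} {ω : ℤ}
  {A : (Fin n → ℂ) → (Fin p → ℝ) → ℂ}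

theorem exists_norm_power_le (S : ℝ) :
    ∃ C : ℝ, 0 ≤ C ∧ ∀ b : Fin n → ℂ, ‖b‖ ≤ S → ∀ x ∈ octant p,
      ‖L.power b x‖ ≤ C * (1 + ‖x‖) ^ (-(L.d * (∑ j, b j).re)) := by
  obtain ⟨C, hC⟩ := L.exists_norm_sub_le
  refine ⟨Real.exp (∑ _j : Fin n, |S| * |C|), (Real.exp_pos _).le, fun b hb x hx => ?_⟩
  have hx0 : 0 < 1 + ‖x‖ := by positivity
  rw [power, Complex.norm_exp, Real.rpow_def_of_pos hx0, ← Real.exp_add, Real.exp_le_exp]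
  have h1 : -∑ j, b j * L.ℓ j x = -∑ j, b j * (L.ℓ j x - L.d * Real.log (1 + ‖x‖)) +
      ((Real.log (1 + ‖x‖) : ℝ) : ℂ) * -((L.d : ℝ) * ∑ j, b j) := by
    simp only [mul_sub, Finset.sum_sub_distrib, ← Finset.sum_mul]
    push_cast
    ring
  rw [h1, Complex.add_re, Complex.re_ofReal_mul, Complex.neg_re, Complex.neg_re,
    Complex.re_ofReal_mul]
  gcongr
  rw [← Complex.neg_re]
  refine (Complex.re_le_norm _).trans ?_
  rw [norm_neg]
  refine norm_sum_le_of_le _ fun j _ => ?_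
  rw [norm_mul]
  gcongr
  · exact (norm_le_pi_norm b j).trans (hb.trans (le_abs_self S))
  · exact (hC j x hx).trans (le_abs_self C)

theorem exists_norm_mul_power_le (hA : Amp L.F L.D pure ω A) (S : ℝ) :
    ∃ C : ℝ, 0 ≤ C ∧ ∀ b : Fin n → ℂ, ‖b‖ ≤ S → ∀ x ∈ octant p,
      ‖A b x * L.power b x‖ ≤ C * (1 + ‖x‖) ^ (ω - L.d * (∑ j, b j).re) := by
  obtain ⟨C₁, h₁, hA⟩ := hA.exists_norm_le L.exists_le_norm_F S
  obtain ⟨C₂, h₂, hP⟩ := L.exists_norm_power_le S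
  refine ⟨C₁ * C₂, by positivity, fun b hb x hx => ?_⟩
  have hx0 : 0 < 1 + ‖x‖ := by positivity
  rw [norm_mul, sub_eq_add_neg, Real.rpow_add hx0]
  calc _ ≤ (C₁ * (1 + ‖x‖) ^ (ω : ℝ)) * (C₂ * (1 + ‖x‖) ^ (-(L.d * (∑ j, b j).re))) :=
        mul_le_mul (hA b hb x hx) (hP b hb x hx) (norm_nonneg _) (by positivity)
    _ = _ := by ring

theorem summable_mul_power (hA : Amp L.F L.D pure ω A) {b : Fin n → ℂ}
    (hb : ω - L.d * (∑ j, b j).re < -p) :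
    Summable fun k => A b (natPoint k) * L.power b (natPoint k) := by
  obtain ⟨C, -, hC⟩ := L.exists_norm_mul_power_le hA ‖b‖
  exact .of_norm_bounded ((summable_one_add_norm_natPoint_rpow hb).mul_left C)
    fun k => hC b le_rfl _ (natPoint_mem_octant k)

theorem differentiable_mul_power (hA : Amp L.F L.D pure ω A) (a : Fin n → ℂ) (x : Fin p → ℝ) :
    Differentiable ℂ fun s : ℂ => A (s • a) x * L.power (s • a) x := by
  refine (hA.differentiable a x).mul ?_
  simp only [power, Pi.smul_apply, smul_eq_mul]
  fun_prop

theorem exists_taylor_seq (hA : Amp L.F L.D pure ω A) (i : Fin p) :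
    ∃ B : ℕ → (Fin n → ℂ) → (Fin p → ℝ) → ℂ, B 0 = A ∧ ∀ j : ℕ,
      Amp L.F L.D pure (ω - j) (B j) ∧ ∀ b, ∀ x ∈ octant p, HasDerivWithinAt
        (fun t => B j b (Function.update x i t) * L.power b (Function.update x i t))
        (B (j + 1) b x * L.power b x) (Set.Ici 0) (x i) := by
  have step : ∀ (ω : ℤ) (A : {A : (Fin n → ℂ) → (Fin p → ℝ) → ℂ // Amp L.F L.D pure ω A}),
      ∃ A' : {A : (Fin n → ℂ) → (Fin p → ℝ) → ℂ // Amp L.F L.D pure (ω - 1) A},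
      ∀ b, ∀ x ∈ octant p, HasDerivWithinAt
        (fun t => A.1 b (Function.update x i t) * L.power b (Function.update x i t))
        (A'.1 b x * L.power b x) (Set.Ici 0) (x i) := fun ω A => by
    obtain ⟨A', h1, h2⟩ := L.exists_hasDerivWithinAt_mul_power A.2 i
    exact ⟨⟨A', h1⟩, h2⟩
  choose next hnext using step
  let B : ∀ j : ℕ, {A : (Fin n → ℂ) → (Fin p → ℝ) → ℂ // Amp L.F L.D pure (ω - j) A} :=
    fun j => Nat.rec ⟨A, by simpa using hA⟩
      (fun j A => ⟨(next _ A).1, by push_cast; rw [← sub_sub]; exact (next _ A).2⟩) j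
  exact ⟨fun j => (B j).1, rfl, fun j => ⟨(B j).2, hnext _ (B j)⟩⟩

/-- The telescoping sums of `xᵢ A ∏ exp(-bⱼ ℓⱼ)` are expanded by Taylor: the first derivatives give
the Euler term, the higher ones go into `W`, and the Taylor error is `R`. The bound `ω + 1` in the
convergence condition is the order of `xᵢ A`. -/
theorem exists_recurrence (hA : Amp L.F L.D pure ω A) (M : ℕ) :
    ∃ (W : (Fin n → ℂ) → (Fin p → ℝ) → ℂ) (R : (Fin n → ℂ) → (Fin p → ℕ) → ℂ),
      Amp L.F L.D pure (ω - 1) W ∧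
      (∀ a k, Differentiable ℂ fun s : ℂ => R (s • a) k) ∧
      (∀ S : ℝ, ∃ C : ℝ, 0 ≤ C ∧ ∀ b : Fin n → ℂ, ‖b‖ ≤ S → ∀ k,
        ‖R b k‖ ≤ C * (1 + ‖natPoint k‖) ^ ((ω - M : ℝ) - L.d * (∑ j, b j).re)) ∧
      ∀ b : Fin n → ℂ, ω + 1 - L.d * (∑ j, b j).re < -p →
        HasSum (fun k => (ω + p - L.d * ∑ j, b j) * (A b (natPoint k) * L.power b (natPoint k)) +
          W b (natPoint k) * L.power b (natPoint k) + R b k) 0 := by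
  obtain ⟨B₀, V, hB₀, hV, hder₀, heuler⟩ := L.exists_euler hA
  choose B hB0 hB using fun i => L.exists_taylor_seq (hB₀ i) i
  have hX : ∀ i : Fin p, Amp L.F L.D pure (ω + 1)
      (fun b x => evalReal (MvPolynomial.X i) x * A b x) := fun i =>
    hA.mulPoly (δ := 1) (by simp [MvPolynomial.totalDegree_X])
  set ψ : Fin p → (Fin n → ℂ) → (Fin p → ℝ) → ℂ := fun i b x =>
    evalReal (MvPolynomial.X i) x * A b x * L.power b x with hψ
  set R : (Fin n → ℂ) → (Fin p → ℕ) → ℂ := fun b k => ∑ i, (ψ i b (natPoint (k + Pi.single i 1)) -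
    ψ i b (natPoint k) - ∑ j ∈ Finset.range (M + 1), ((j + 1).factorial : ℂ)⁻¹ *
      (B i j b (natPoint k) * L.power b (natPoint k))) with hR
  refine ⟨fun b x => V b x + ∑ i, ∑ j ∈ Finset.range M,
    ((j + 2).factorial : ℂ)⁻¹ * B i (j + 1) b x, R, ?_, ?_, ?_, ?_⟩
  · refine hV.add (.sum fun i _ => .sum fun j _ => (((hB i (j + 1)).1).mono_order ?_).smul _)
    push_cast
    linarith [j.cast_nonneg (α := ℤ)]
  · intro a k
    refine Differentiable.fun_sum fun i _ => ((L.differentiable_mul_power (hX i) a _).sub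
      (L.differentiable_mul_power (hX i) a _)).sub (Differentiable.fun_sum fun j _ =>
        (L.differentiable_mul_power (hB i j).1 a _).const_mul _)
  · intro S
    have hC : ∀ i : Fin p, ∃ C : ℝ, 0 ≤ C ∧ ∀ b : Fin n → ℂ, ‖b‖ ≤ S → ∀ x ∈ octant p,
        ‖B i (M + 1) b x * L.power b x‖ ≤
          C * (1 + ‖x‖) ^ ((ω - (M + 1 : ℕ) : ℤ) - L.d * (∑ j, b j).re) := fun i =>
      L.exists_norm_mul_power_le (hB i (M + 1)).1 S
    choose C hC0 hC using hC
    -- `K` bounds `|ρ|` for all `b` with `‖b‖ ≤ S`, which makes the factor `2 ^ |ρ|` uniform in `b`.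
    set K : ℝ := |((ω - (M + 1 : ℕ) : ℤ) : ℝ)| + L.d * (n * |S|) with hK
    refine ⟨∑ i, C i * 2 ^ K, Finset.sum_nonneg fun i _ => mul_nonneg (hC0 i) (by positivity),
      fun b hb k => ?_⟩
    have hsum : |(∑ j, b j).re| ≤ n * |S| := by
      refine (Complex.abs_re_le_norm _).trans ((norm_sum_le_of_le Finset.univ fun j _ =>
        (norm_le_pi_norm b j).trans (hb.trans (le_abs_self S))).trans ?_)
      simp
    set ρ : ℝ := (ω - (M + 1 : ℕ) : ℤ) - L.d * (∑ j, b j).re with hρ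
    have hρK : |ρ| ≤ K := by
      refine (abs_sub _ _).trans ?_
      rw [abs_mul, Nat.abs_cast, hK]
      gcongr
    have hx := natPoint_mem_octant k
    set x := natPoint k with hxk
    rw [Finset.sum_mul]
    refine norm_sum_le_of_le _ fun i _ => ?_
    -- The successive derivatives along the edge from `k` to `k + eᵢ`. The index shift makes `B i j`
    -- the derivative of order `j + 1` of `ψ i`.
    obtain ⟨φ, hφ0, hφs⟩ : ∃ φ : ℕ → ℝ → ℂ, (φ 0 = fun t => ψ i b (Function.update x i t)) ∧
        ∀ j, φ (j + 1) = fun t =>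
          B i j b (Function.update x i t) * L.power b (Function.update x i t) :=
      ⟨fun j t => Nat.casesOn j (ψ i b (Function.update x i t))
        fun j => B i j b (Function.update x i t) * L.power b (Function.update x i t),
        rfl, fun _ => rfl⟩
    have hupd : ∀ t ∈ Set.Icc (x i) (x i + 1), Function.update x i t ∈ octant p := fun t ht =>
      update_mem_octant hx i ((hx i).trans ht.1)
    have hφ : ∀ j < M + 2, ∀ t ∈ Set.Icc (x i) (x i + 1),
        HasDerivWithinAt (φ j) (φ (j + 1) t) (Set.Icc (x i) (x i + 1)) t := by
      intro j _ t ht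
      have hsub : Set.Icc (x i) (x i + 1) ⊆ Set.Ici 0 := fun u hu => (hx i).trans hu.1
      rcases j with _ | j
      · have := hder₀ i b _ (hupd t ht)
        simp only [Function.update_idem, Function.update_self] at this
        simpa only [hφ0, hφs, hB0, ψ] using this.mono hsub
      · have := (hB i j).2 b _ (hupd t ht)
        simp only [Function.update_idem, Function.update_self] at this
        simpa only [hφs] using this.mono hsub
    have hbd : ∀ t ∈ Set.Icc (x i) (x i + 1),
        ‖φ (M + 2) t‖ ≤ C i * 2 ^ K * (1 + ‖x‖) ^ ρ := by
      intro t ht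
      obtain ⟨h1, h2⟩ := norm_le_norm_update hx i ht
      rw [hφs]
      refine (hC i b hb _ (hupd t ht)).trans ?_
      rw [mul_assoc]
      gcongr
      · exact hC0 i
      · refine (rpow_le_two_rpow_mul (u := 1 + ‖x‖) (by positivity) (by linarith)
          (by linarith [norm_nonneg x]) ρ).trans ?_
        gcongr
        norm_num
    have htay := norm_sub_taylor_sum_le (M + 2) φ hφ hbd (x i + 1) ⟨by linarith, le_rfl⟩
    have hρ' : ρ ≤ (ω - M : ℝ) - L.d * (∑ j, b j).re := by
      rw [hρ]; push_cast; linarith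
    refine (le_of_eq ?_).trans (htay.trans ?_)
    · congr 1
      rw [Finset.sum_range_succ' _ (M + 1), natPoint_add_single]
      simp only [hφ0, hφs, Function.update_eq_self, add_sub_cancel_left, ← hxk,
        Complex.ofReal_one, one_pow, mul_one, Nat.factorial_zero, Nat.cast_one, inv_one, one_mul,
        div_eq_inv_mul]
      ring
    · gcongr
      · exact mul_nonneg (hC0 i) (by positivity)
      · linarith [norm_nonneg x]
  · intro b hb
    have htel : HasSum (fun k => ∑ i, (ψ i b (natPoint (k + Pi.single i 1)) -
        ψ i b (natPoint k))) 0 := by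
      have := hasSum_sum (s := Finset.univ) (a := fun _ : Fin p => (0 : ℂ)) fun i _ =>
        hasSum_sub_shift_eq_zero (L.summable_mul_power (hX i) (b := b)
          (by push_cast; exact hb)) i
          (fun k hk => by simp [evalReal, natPoint, hk])
      simpa using this
    refine htel.congr_fun fun k => ?_
    have he := heuler b _ (natPoint_mem_octant k)
    simp only [hR, Finset.sum_sub_distrib, Finset.sum_range_succ', zero_add, Nat.factorial_one,
      Nat.cast_one, inv_one, one_mul, hB0, Finset.sum_add_distrib, ← Finset.sum_mul, he,
      add_mul, ← mul_assoc]
    ring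

end LogSystem

/-! ### Continuation along lines and its value at the origin. -/

open Filter Topology in
/-- Along every line `b = s • a` with `∑ aⱼ = 1`, the sum `∑ₖ Φ(b, k)`, convergent for `Re s > σ`,
has a meromorphic continuation `Z` to `Re s > -T` such that `s ^ q * Z s` tends to `V a` at `0`. -/
def HasContinuation {p n : ℕ} (T σ : ℝ) (q : ℕ) (V : (Fin n → ℂ) → ℂ)
    (Φ : (Fin n → ℂ) → (Fin p → ℕ) → ℂ) : Prop :=
  ∀ a : Fin n → ℂ, ∑ j, a j = 1 → ∃ Z : ℂ → ℂ, MeromorphicOn Z {s | -T < s.re} ∧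
    Tendsto (fun s => s ^ q * Z s) (𝓝[≠] 0) (𝓝 (V a)) ∧
    ∀ s : ℂ, σ < s.re → HasSum (Φ (s • a)) (Z s)

namespace HasContinuation

open Filter Topology

variable {p n : ℕ} {T σ : ℝ} {q : ℕ} {V V' : (Fin n → ℂ) → ℂ}
  {Φ Φ' : (Fin n → ℂ) → (Fin p → ℕ) → ℂ}

theorem congr (h : HasContinuation T σ q V Φ) (hV : ∀ a, ∑ j, a j = 1 → V a = V' a) :
    HasContinuation T σ q V' Φ := fun a ha => hV a ha ▸ h a ha

theorem zero : HasContinuation (p := p) (n := n) T σ q (fun _ => 0) (fun _ _ => 0) := fun _ _ =>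
  ⟨fun _ => 0, fun _ _ => MeromorphicAt.const 0 _, by simp, fun _ _ => hasSum_zero⟩

theorem add (h : HasContinuation T σ q V Φ) (h' : HasContinuation T σ q V' Φ') :
    HasContinuation T σ q (fun a => V a + V' a) (fun b k => Φ b k + Φ' b k) := by
  intro a ha
  obtain ⟨Z, h1, h2, h3⟩ := h a ha
  obtain ⟨Z', h1', h2', h3'⟩ := h' a ha
  exact ⟨fun s => Z s + Z' s, h1.add h1', by simpa only [mul_add] using h2.add h2',
    fun s hs => (h3 s hs).add (h3' s hs)⟩

theorem smul (c : ℂ) (h : HasContinuation T σ q V Φ) :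
    HasContinuation T σ q (fun a => c * V a) (fun b k => c * Φ b k) := by
  intro a ha
  obtain ⟨Z, h1, h2, h3⟩ := h a ha
  exact ⟨fun s => c * Z s, (MeromorphicOn.const c).mul h1,
    by simpa only [mul_left_comm] using h2.const_mul c, fun s hs => (h3 s hs).mul_left c⟩

/-- On the line `b = s • a` the factor `bⱼ` is `s aⱼ`, so it absorbs one power of `s`. -/
theorem mulVar (j : Fin n) (h : HasContinuation T σ (q + 1) V Φ) :
    HasContinuation T σ q (fun a => a j * V a) (fun b k => b j * Φ b k) := by
  intro a ha
  obtain ⟨Z, h1, h2, h3⟩ := h a ha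
  refine ⟨fun s => s * a j * Z s,
    (MeromorphicOn.id.mul (MeromorphicOn.const (a j))).mul h1,
    (h2.const_mul (a j)).congr fun s => by ring, fun s hs => (h3 s hs).mul_left (s * a j)⟩

theorem succ (h : HasContinuation T σ q V Φ) :
    HasContinuation T σ (q + 1) (fun _ => 0) Φ := by
  intro a ha
  obtain ⟨Z, h1, h2, h3⟩ := h a ha
  refine ⟨Z, h1, ?_, h3⟩
  have h4 : Tendsto (fun s : ℂ => s) (𝓝[≠] 0) (𝓝 0) := tendsto_id.mono_left nhdsWithin_le_nhds
  simpa using (h4.mul h2).congr fun s => by rw [pow_succ']; ring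

/-- For `Re s > -T` the exponent is at most `-p - 1`, so the series converges locally uniformly and
is holomorphic there. -/
theorem of_norm_le {d ρ : ℝ} (hd : 0 ≤ d) (hT : 0 < T) (hσ : 0 ≤ σ)
    (hdiff : ∀ a k, Differentiable ℂ fun s : ℂ => Φ (s • a) k)
    (hb : ∀ S : ℝ, ∃ C : ℝ, 0 ≤ C ∧ ∀ b : Fin n → ℂ, ‖b‖ ≤ S → ∀ k,
      ‖Φ b k‖ ≤ C * (1 + ‖natPoint k‖) ^ (ρ - d * (∑ j, b j).re))
    (hρ : ρ + d * T ≤ -p - 1) :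
    HasContinuation T σ 0 (fun _ => ∑' k, Φ 0 k) Φ := by
  intro a ha
  have hsum : ∀ s : ℂ, (∑ j, (s • a) j) = s := fun s => by
    simp [← Finset.mul_sum, ha]
  have key : ∀ S : ℝ, ∃ u : (Fin p → ℕ) → ℝ, Summable u ∧ ∀ k, ∀ s : ℂ, -T < s.re → ‖s‖ < S →
      ‖Φ (s • a) k‖ ≤ u k := by
    intro S
    obtain ⟨C, hC, hb⟩ := hb (S * ‖a‖)
    refine ⟨fun k => C * (1 + ‖natPoint k‖) ^ (-(p : ℝ) - 1),
      (summable_one_add_norm_natPoint_rpow (by linarith)).mul_left C, fun k s hs hsS => ?_⟩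
    refine (hb (s • a) (by rw [norm_smul]; gcongr) k).trans ?_
    rw [hsum]
    refine mul_le_mul_of_nonneg_left (Real.rpow_le_rpow_of_exponent_le ?_ ?_) hC
    · linarith [norm_nonneg (natPoint k)]
    · nlinarith
  have hopen : IsOpen {s : ℂ | -T < s.re} := isOpen_lt continuous_const Complex.continuous_re
  have hdiffOn : DifferentiableOn ℂ (fun s => ∑' k, Φ (s • a) k) {s : ℂ | -T < s.re} := by
    intro s hs
    obtain ⟨u, hu, hle⟩ := key (‖s‖ + 1)
    have hU : IsOpen ({s : ℂ | -T < s.re} ∩ Metric.ball 0 (‖s‖ + 1)) :=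
      hopen.inter Metric.isOpen_ball
    have := Complex.differentiableOn_tsum_of_summable_norm hu
      (fun k => (hdiff a k).differentiableOn) hU
      (fun k w hw => hle k w hw.1 (by simpa using hw.2))
    exact (this.differentiableAt (hU.mem_nhds ⟨hs, by simp⟩)).differentiableWithinAt
  have h0 : (0 : ℂ) ∈ {s : ℂ | -T < s.re} := by simpa using hT
  refine ⟨fun s => ∑' k, Φ (s • a) k, (hdiffOn.analyticOnNhd hopen).meromorphicOn, ?_, ?_⟩
  · have := (hdiffOn.differentiableAt (hopen.mem_nhds h0)).continuousAt.tendsto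
    simpa using this.mono_left nhdsWithin_le_nhds
  · intro s hs
    obtain ⟨u, hu, hle⟩ := key (‖s‖ + 1)
    exact (Summable.of_norm_bounded hu fun k => hle k s (by linarith) (by linarith)).hasSum

end HasContinuation

namespace LogSystem

open Filter Topology

variable {p n : ℕ} (L : LogSystem p n) {pure : Bool} {ω : ℤ}
  {A : (Fin n → ℂ) → (Fin p → ℝ) → ℂ} {T σ : ℝ}

/-- The term at `k` of the series with amplitude `A`. -/
noncomputable def term (A : (Fin n → ℂ) → (Fin p → ℝ) → ℂ) (b : Fin n → ℂ) (k : Fin p → ℕ) : ℂ :=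
  A b (natPoint k) * L.power b (natPoint k)

theorem term_eq (A : (Fin n → ℂ) → (Fin p → ℝ) → ℂ) :
    L.term A = fun b k => A b (natPoint k) * L.power b (natPoint k) := rfl

/-- The recurrence is divided by `ω + p - d s`. The remainder is regular at `0`, and its value there
does not depend on `a`; against `s ^ q` it counts only for `q = 0`, hence `0 ^ q * c`. In the
resonant case `ω = -p` the divisor is `-d s`, and the pole order goes up by one. -/
theorem exists_hasContinuation_step (hT : 0 < T) (hσ : 0 ≤ σ) (hωσ : ω + 1 + p ≤ L.d * σ)
    (hA : Amp L.F L.D pure ω A) :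
    ∃ (W : (Fin n → ℂ) → (Fin p → ℝ) → ℂ) (c : ℂ), Amp L.F L.D pure (ω - 1) W ∧
      ∀ q V, HasContinuation T σ q V (L.term W) →
        (ω + p ≠ 0 →
          HasContinuation T σ q (fun a => -(V a + 0 ^ q * c) / (ω + p : ℤ)) (L.term A)) ∧
        (ω + p = 0 →
          HasContinuation T σ (q + 1) (fun a => (V a + 0 ^ q * c) / L.d) (L.term A)) := by
  obtain ⟨M, hM⟩ := exists_nat_ge (ω + L.d * T + p + 1)
  obtain ⟨W, R, hW, hR1, hR2, hR3⟩ := L.exists_recurrence hA M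
  have hRcont := HasContinuation.of_norm_le (σ := σ) L.d.cast_nonneg hT hσ hR1 hR2 (by linarith)
  have hd : (0 : ℝ) < L.d := by exact_mod_cast L.d_pos
  have hdC : (L.d : ℂ) ≠ 0 := by exact_mod_cast L.d_pos.ne'
  refine ⟨W, ∑' k, R 0 k, hW, fun q V hV => ?_⟩
  have key : ∀ a : Fin n → ℂ, ∑ j, a j = 1 → ∃ Z : ℂ → ℂ, MeromorphicOn Z {s | -T < s.re} ∧
      Tendsto (fun s => s ^ q * Z s) (𝓝[≠] 0) (𝓝 (V a + 0 ^ q * ∑' k, R 0 k)) ∧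
      ∀ s : ℂ, σ < s.re → HasSum (L.term A (s • a)) (-Z s / ((ω + p : ℤ) - L.d * s)) := by
    intro a ha
    obtain ⟨Z, h1, h2, h3⟩ := hV a ha
    obtain ⟨Z', h1', h2', h3'⟩ := hRcont a ha
    have hsum : ∀ s : ℂ, (∑ j, (s • a) j) = s := fun s => by simp [← Finset.mul_sum, ha]
    refine ⟨fun s => Z s + Z' s, h1.add h1', ?_, ?_⟩
    · have h4 : Tendsto (fun s : ℂ => s ^ q) (𝓝[≠] 0) (𝓝 (0 ^ q)) :=
        ((continuous_pow q).tendsto 0).mono_left nhdsWithin_le_nhds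
      simp only [pow_zero, one_mul] at h2'
      simpa only [mul_add] using h2.add (h4.mul h2')
    · intro s hs
      have hds : L.d * σ < L.d * s.re := mul_lt_mul_of_pos_left hs hd
      have hne : ((ω + p : ℤ) : ℂ) - L.d * s ≠ 0 := by
        intro h
        have := congrArg Complex.re h
        simp only [Complex.sub_re, Complex.intCast_re, Complex.mul_re, Complex.natCast_re,
          Complex.natCast_im, zero_mul, sub_zero, Complex.zero_re] at this
        push_cast at this
        linarith
      have h4 := hR3 (s • a) (by rw [hsum]; linarith)
      have h5 := ((h4.sub (h3 s hs)).sub (h3' s hs)).div_const ((ω + p : ℤ) - L.d * s : ℂ)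
      rw [show (0 - Z s - Z' s : ℂ) = -(Z s + Z' s) by ring] at h5
      refine h5.congr_fun fun k => ?_
      rw [hsum]
      simp only [term]
      push_cast at hne ⊢
      field_simp
      ring
  constructor
  · intro hω a ha
    obtain ⟨Z, h1, h2, h3⟩ := key a ha
    refine ⟨fun s => -Z s / ((ω + p : ℤ) - L.d * s), h1.neg.div fun s _ => ?_, ?_, h3⟩
    · exact AnalyticAt.meromorphicAt (by fun_prop)
    · have h4 : Tendsto (fun s : ℂ => ((ω + p : ℤ) : ℂ) - L.d * s) (𝓝[≠] 0)
          (𝓝 ((ω + p : ℤ) : ℂ)) := by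
        have : Continuous fun s : ℂ => ((ω + p : ℤ) : ℂ) - L.d * s := by fun_prop
        exact (this.tendsto' 0 _ (by simp)).mono_left nhdsWithin_le_nhds
      exact (h2.neg.div h4 (by exact_mod_cast hω)).congr fun s => by
        rw [Pi.div_apply]; ring
  · intro hω a ha
    obtain ⟨Z, h1, h2, h3⟩ := key a ha
    refine ⟨fun s => -Z s / ((ω + p : ℤ) - L.d * s), h1.neg.div fun s _ => ?_, ?_, h3⟩
    · exact AnalyticAt.meromorphicAt (by fun_prop)
    · refine (h2.div_const (L.d : ℂ)).congr' ?_
      filter_upwards [self_mem_nhdsWithin] with s hs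
      have hs : s ≠ 0 := hs
      rw [hω, pow_succ]
      push_cast
      field_simp
      ring

/-- Below `-p` no resonance occurs. The order is lowered until the series itself converges for `Re s
> -T`; there the value at `0` is the sum at `b = 0`, independent of `a`. -/
theorem exists_hasContinuation_of_lt (hT : 0 < T) (hσ : 0 ≤ σ) (hω : ω < -p)
    (hA : Amp L.F L.D pure ω A) : ∃ c, HasContinuation T σ 0 (fun _ => c) (L.term A) := by
  obtain ⟨N, hN⟩ := exists_nat_ge (ω + L.d * T + p + 1)
  have hd : (0 : ℝ) < L.d := by exact_mod_cast L.d_pos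
  induction N generalizing ω A with
  | zero =>
    refine ⟨_, HasContinuation.of_norm_le (d := L.d) (ρ := ω) L.d.cast_nonneg hT hσ
      (fun a k => L.differentiable_mul_power hA a _) (fun S => ?_)
      (by push_cast at hN; linarith)⟩
    obtain ⟨C, hC, h⟩ := L.exists_norm_mul_power_le hA S
    exact ⟨C, hC, fun b hb k => h b hb _ (natPoint_mem_octant k)⟩
  | succ N ih =>
    have hω' : (ω : ℝ) + 1 + p ≤ 0 := by exact_mod_cast (by omega : ω + 1 + p ≤ 0)
    obtain ⟨W, c, hW, hstep⟩ := L.exists_hasContinuation_step hT hσ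
      (hω'.trans (mul_nonneg hd.le hσ)) hA
    obtain ⟨c', hc'⟩ := ih (by omega) hW (by push_cast at hN ⊢; linarith)
    exact ⟨_, (hstep 0 _ hc').1 (by omega)⟩

/-- Descending in the order meets the resonance `ω = -p` at most once, so one factor `s` suffices
and the limit stays constant in `a`. -/
theorem exists_hasContinuation_one (hT : 0 < T) (hσ : 0 ≤ σ) (hωσ : ω + 1 + p ≤ L.d * σ)
    (hA : Amp L.F L.D pure ω A) : ∃ c, HasContinuation T σ 1 (fun _ => c) (L.term A) := by
  obtain ⟨N, hN⟩ : ∃ N : ℕ, ω < -p + N := ⟨(ω + p + 1).toNat, by omega⟩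
  induction N generalizing ω A with
  | zero =>
    obtain ⟨c, hc⟩ := L.exists_hasContinuation_of_lt hT hσ (by simpa using hN) hA
    exact ⟨_, hc.succ⟩
  | succ N ih =>
    obtain ⟨W, c, hW, hstep⟩ := L.exists_hasContinuation_step hT hσ hωσ hA
    rcases eq_or_ne (ω + p) 0 with hω | hω
    · obtain ⟨c', hc'⟩ := L.exists_hasContinuation_of_lt hT hσ (by omega) hW
      exact ⟨_, (hstep 0 _ hc').2 hω⟩
    · obtain ⟨c', hc'⟩ := ih (by push_cast; linarith) hW (by push_cast at hN; omega)
      exact ⟨_, (hstep 1 _ hc').1 hω⟩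

/-- A polynomial of negative order is impossible, so only terms with a factor `bⱼ` remain. Each
contributes `aⱼ` times the constant limit of `s Z(s)`. -/
theorem exists_hasContinuation_pure_of_neg (hT : 0 < T) (hσ : 0 ≤ σ) (hωσ : ω + 1 + p ≤ L.d * σ)
    (hω : ω < 0) (hA : Amp L.F L.D true ω A) :
    ∃ c : Fin n → ℂ, HasContinuation T σ 0 (fun a => ∑ j, c j * a j) (L.term A) := by
  generalize hp : true = pure at hA
  induction hA with
  | zero => exact ⟨0, by simpa [term_eq] using HasContinuation.zero⟩
  | quot h k m hh hm hk =>
    rw [hm hp.symm] at hk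
    simp at hk
    omega
  | add _ _ h1 h2 =>
    obtain ⟨c₁, h1⟩ := h1 hωσ hω hp
    obtain ⟨c₂, h2⟩ := h2 hωσ hω hp
    refine ⟨c₁ + c₂, ?_⟩
    simpa [term_eq, add_mul, Finset.sum_add_distrib] using h1.add h2
  | smul c _ h1 =>
    obtain ⟨c₁, h1⟩ := h1 hωσ hω hp
    refine ⟨c • c₁, ?_⟩
    simpa [term_eq, mul_assoc, Finset.mul_sum] using h1.smul c
  | mulVar j hA _ =>
    obtain ⟨c, hc⟩ := L.exists_hasContinuation_one hT hσ hωσ hA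
    refine ⟨Pi.single j c, ?_⟩
    have := (hc.mulVar j).congr (V' := fun a => ∑ i, (Pi.single j c : Fin n → ℂ) i * a i)
      fun a _ => by simp [Pi.single_apply, mul_comm]
    simpa only [term_eq, mul_assoc] using this

/-- While `ω ≥ 0`, the divisor `ω + p` is positive because `p > 0`, so no pole arises before the
order becomes negative. -/
theorem exists_hasContinuation_pure (hp : 0 < p) (hT : 0 < T) (hσ : 0 ≤ σ)
    (hωσ : ω + 1 + p ≤ L.d * σ) (hA : Amp L.F L.D true ω A) :
    ∃ c : Fin n → ℂ, HasContinuation T σ 0 (fun a => ∑ j, c j * a j) (L.term A) := by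
  obtain ⟨N, hN⟩ : ∃ N : ℕ, ω < N := ⟨(ω + 1).toNat, by omega⟩
  induction N generalizing ω A with
  | zero => exact L.exists_hasContinuation_pure_of_neg hT hσ hωσ (by simpa using hN) hA
  | succ N ih =>
    rcases lt_or_ge ω 0 with hω | hω
    · exact L.exists_hasContinuation_pure_of_neg hT hσ hωσ hω hA
    obtain ⟨W, c, hW, hstep⟩ := L.exists_hasContinuation_step hT hσ hωσ hA
    obtain ⟨c', hc'⟩ := ih (by push_cast; linarith) hW (by push_cast at hN; omega)
    refine ⟨fun j => -(c' j + c) / (ω + p : ℤ),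
      ((hstep 0 _ hc').1 (by omega)).congr fun a ha => ?_⟩
    -- The condition `∑ aⱼ = 1` turns the affine value into a linear one.
    have : ∑ j, (c' j + c) * a j = ∑ j, c' j * a j + c := by
      simp [add_mul, Finset.sum_add_distrib, ← Finset.mul_sum, ha]
    simp only [pow_zero, one_mul, ← this, neg_div, neg_mul, Finset.sum_neg_distrib,
      div_mul_eq_mul_div, Finset.sum_div]

end LogSystem

/-! ### Identity theorem and gluing of the half-plane continuations. -/

section Continuation

open Filter Topology

theorem eventuallyEq_of_meromorphicOn_halfPlane {Z Z' : ℂ → ℂ} {T σ : ℝ}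
    (hZ : MeromorphicOn Z {s | -T < s.re}) (hZ' : MeromorphicOn Z' {s | -T < s.re})
    (h : ∀ s : ℂ, σ < s.re → Z s = Z' s) {s₀ : ℂ} (hs₀ : -T < s₀.re) : Z =ᶠ[𝓝[≠] s₀] Z' := by
  have hpre : IsPreconnected {s : ℂ | -T < s.re} := (convex_halfSpace_re_gt _).isPreconnected
  have hsub := hZ.sub hZ'
  set t : ℂ := ((max σ (-T) + 1 : ℝ) : ℂ) with ht
  have htT : -T < t.re := by
    rw [ht, Complex.ofReal_re]; linarith [le_max_right σ (-T)]
  have htσ : σ < t.re := by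
    rw [ht, Complex.ofReal_re]; linarith [le_max_left σ (-T)]
  have htop : meromorphicOrderAt (Z - Z') t = ⊤ := by
    rw [meromorphicOrderAt_eq_top_iff]
    refine eventually_nhdsWithin_of_eventually_nhds ?_
    filter_upwards [(isOpen_lt continuous_const Complex.continuous_re).mem_nhds htσ] with s hs
    simp [h s hs]
  have h0 : meromorphicOrderAt (Z - Z') s₀ = ⊤ := by
    by_contra hne
    exact hsub.meromorphicOrderAt_ne_top_of_isPreconnected hpre hs₀ htT hne htop
  rw [meromorphicOrderAt_eq_top_iff] at h0
  filter_upwards [h0] with s hs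
  exact sub_eq_zero.mp hs

/-- The value at `s` is taken from a half-plane chosen by `⌈|Re s|⌉`. By the identity theorem all
choices agree on punctured neighbourhoods, which is enough for meromorphy. -/
theorem exists_meromorphicOn_univ {ι : Type*} {Φ : ℂ → ι → ℂ} {σ : ℝ} (hσ : 0 ≤ σ) {v : ℂ}
    (h₀ : ∃ Z : ℂ → ℂ, MeromorphicOn Z {s | -1 < s.re} ∧ Tendsto Z (𝓝[≠] 0) (𝓝 v) ∧
      ∀ s : ℂ, σ < s.re → HasSum (Φ s) (Z s))
    (h : ∀ N : ℕ, ∃ Z : ℂ → ℂ, MeromorphicOn Z {s | -(N + 1 : ℝ) < s.re} ∧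
      ∀ s : ℂ, σ < s.re → HasSum (Φ s) (Z s)) :
    ∃ Z : ℂ → ℂ, MeromorphicOn Z Set.univ ∧ AnalyticAt ℂ Z 0 ∧ Z 0 = v ∧
      ∀ s : ℂ, σ < s.re → HasSum (Φ s) (Z s) := by
  obtain ⟨Z₀, hm₀, hv, hs₀⟩ := h₀
  choose Zf hm hs using h
  set Y : ℂ → ℂ := fun s => Zf ⌈|s.re|⌉₊ s with hY
  have hloc : ∀ N : ℕ, ∀ s₀ : ℂ, -(N + 1 : ℝ) < s₀.re → Y =ᶠ[𝓝[≠] s₀] Zf N := by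
    intro N s₀ hN
    have h1 : ∀ M : ℕ, -(M + 1 : ℝ) < s₀.re → Zf M =ᶠ[𝓝[≠] s₀] Zf N := by
      intro M hM
      have hmin : -((min M N : ℕ) + 1 : ℝ) < s₀.re := by
        rcases min_choice M N with h | h <;> rw [h] <;> assumption
      refine eventuallyEq_of_meromorphicOn_halfPlane (T := (min M N : ℕ) + 1) (σ := σ)
        ((hm M).mono_set fun s hs => ?_) ((hm N).mono_set fun s hs => ?_)
        (fun s hs' => (hs M s hs').unique (hs N s hs')) hmin
      · have : ((min M N : ℕ) : ℝ) ≤ M := by exact_mod_cast min_le_left M N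
        have hs : -((min M N : ℕ) + 1 : ℝ) < s.re := hs
        show -(M + 1 : ℝ) < s.re
        linarith
      · have : ((min M N : ℕ) : ℝ) ≤ N := by exact_mod_cast min_le_right M N
        have hs : -((min M N : ℕ) + 1 : ℝ) < s.re := hs
        show -(N + 1 : ℝ) < s.re
        linarith
    -- Within distance one of `s₀` only finitely many indices occur, so one punctured neighbourhood
    -- serves them all.
    have h2 : ∀ᶠ s in 𝓝[≠] s₀, ∀ M ∈ Finset.range (⌈|s₀.re|⌉₊ + 2),
        -(M + 1 : ℝ) < s₀.re → Zf M s = Zf N s := by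
      rw [Finset.eventually_all]
      intro M _
      by_cases hM : -(M + 1 : ℝ) < s₀.re
      · filter_upwards [h1 M hM] with s hs _ using hs
      · exact Eventually.of_forall fun s h => absurd h hM
    filter_upwards [h2, mem_nhdsWithin_of_mem_nhds (Metric.ball_mem_nhds s₀ one_pos)] with s hs hb
    have hb : ‖s - s₀‖ < 1 := by simpa [dist_eq_norm] using hb
    have hre : |s.re - s₀.re| < 1 := by
      rw [← Complex.sub_re]
      exact (Complex.abs_re_le_norm _).trans_lt hb
    have habs := abs_sub_abs_le_abs_sub s.re s₀.re
    have habs' := abs_sub_abs_le_abs_sub s₀.re s.re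
    rw [abs_sub_comm] at habs'
    have hc := Nat.le_ceil |s.re|
    have hc₀ := Nat.le_ceil |s₀.re|
    refine hs _ (Finset.mem_range.mpr ?_) ?_
    · refine Nat.lt_succ_of_le (Nat.ceil_le.mpr ?_)
      push_cast
      linarith
    · linarith [neg_abs_le s₀.re]
  have hYm : MeromorphicOn Y Set.univ := by
    intro s₀ _
    have hN : -((⌈|s₀.re|⌉₊ : ℝ) + 1) < s₀.re := by
      linarith [Nat.le_ceil |s₀.re|, neg_abs_le s₀.re]
    exact (hm _ s₀ hN).congr (hloc _ s₀ hN).symm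
  have hY0 : Tendsto Y (𝓝[≠] 0) (𝓝 v) := by
    refine hv.congr' ?_
    refine EventuallyEq.trans ?_ (hloc 0 0 (by simp)).symm
    exact eventuallyEq_of_meromorphicOn_halfPlane (T := 1) (σ := σ) hm₀ (by simpa using hm 0)
      (fun s hs' => (hs₀ s hs').unique (hs 0 s hs')) (by simp)
  have hup : ∀ s₀, Y =ᶠ[𝓝[≠] s₀] Function.update Y 0 v := by
    intro s₀
    have : ∀ᶠ s in 𝓝[≠] s₀, s ≠ 0 := by
      rcases eq_or_ne s₀ 0 with rfl | h
      · exact self_mem_nhdsWithin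
      · exact mem_nhdsWithin_of_mem_nhds (isOpen_ne.mem_nhds h)
    filter_upwards [this] with s hs
    simp [hs]
  have hZm : MeromorphicOn (Function.update Y 0 v) Set.univ :=
    fun s₀ hs₀ => (hYm s₀ hs₀).congr (hup s₀)
  -- Setting the value at `0` to the limit `v` removes the singularity there.
  refine ⟨Function.update Y 0 v, hZm, ?_, by simp, ?_⟩
  · refine Complex.analyticAt_of_differentiable_on_punctured_nhds_of_continuousAt
      ((hZm 0 trivial).eventually_analyticAt.mono fun s hs => hs.differentiableAt) ?_
    exact continuousAt_update_same.mpr hY0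
  · intro s hsσ
    have : s ≠ 0 := by
      rintro rfl
      simp only [Complex.zero_re] at hsσ
      linarith
    simpa [this] using hs _ s hsσ

theorem IsZetaContinuation.apply_zero_unique {p : ℕ} {g : MvPolynomial (Fin p) ℂ}
    {ℓ : (Fin p → ℝ) → ℂ} {Z Z' : ℂ → ℂ} (h : IsZetaContinuation g ℓ Z)
    (h' : IsZetaContinuation g ℓ Z') (hZ : AnalyticAt ℂ Z 0) (hZ' : AnalyticAt ℂ Z' 0) :
    Z 0 = Z' 0 := by
  obtain ⟨σ, hσ⟩ := h.hasSum
  obtain ⟨σ', hσ'⟩ := h'.hasSum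
  have heq : Z =ᶠ[𝓝[≠] 0] Z' := eventuallyEq_of_meromorphicOn_halfPlane (T := 1) (σ := max σ σ')
    (h.meromorphicOn.mono_set (Set.subset_univ _)) (h'.meromorphicOn.mono_set (Set.subset_univ _))
    (fun s hs => (hσ s ((le_max_left _ _).trans_lt hs)).unique
      (hσ' s ((le_max_right _ _).trans_lt hs))) (by simp)
  exact tendsto_nhds_unique (hZ.continuousAt.tendsto.mono_left nhdsWithin_le_nhds)
    ((hZ'.continuousAt.tendsto.mono_left nhdsWithin_le_nhds).congr' heq.symm)

theorem LogSystem.exists_isZetaContinuation {p n : ℕ} (L : LogSystem p n) (hp : 0 < p)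
    (g : MvPolynomial (Fin p) ℂ) :
    ∃ c : Fin n → ℂ, ∀ a : Fin n → ℂ, ∑ j, a j = 1 → ∃ Z : ℂ → ℂ,
      IsZetaContinuation g (fun x => ∑ j, a j * L.ℓ j x) Z ∧ AnalyticAt ℂ Z 0 ∧
      Z 0 = ∑ j, c j * a j := by
  have hA : Amp (n := n) L.F L.D true g.totalDegree (fun _ x => evalReal g x) := by
    simpa using Amp.of_totalDegree_le (n := n) (F := L.F) (D := L.D) (pure := true)
      (ω := g.totalDegree) (h := g) le_rfl 0 (by simp) (by simp)
  have hd : (1 : ℝ) ≤ L.d := by exact_mod_cast L.d_pos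
  set σ : ℝ := g.totalDegree + 1 + p with hσ
  have hσ0 : 0 ≤ σ := by positivity
  have hωσ : ((g.totalDegree : ℤ) : ℝ) + 1 + p ≤ L.d * σ := by
    rw [Int.cast_natCast, ← hσ]
    exact le_mul_of_one_le_left hσ0 hd
  obtain ⟨c, hc⟩ := L.exists_hasContinuation_pure hp one_pos hσ0 hωσ hA
  refine ⟨c, fun a ha => ?_⟩
  obtain ⟨Z₀, hm, hlim, hs⟩ := hc a ha
  obtain ⟨Z, h1, h2, h3, h4⟩ := exists_meromorphicOn_univ (v := ∑ j, c j * a j)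
    (Φ := fun s => L.term (fun _ x => evalReal g x) (s • a)) hσ0
    ⟨Z₀, hm, by simpa using hlim, hs⟩ fun N => by
      obtain ⟨c', hc'⟩ := L.exists_hasContinuation_pure (T := N + 1) hp (by positivity) hσ0 hωσ hA
      obtain ⟨Z', hm', -, hs'⟩ := hc' a ha
      exact ⟨Z', hm', hs'⟩
  refine ⟨Z, ⟨h1, σ, fun s hs => (h4 s hs).congr_fun fun k => ?_⟩, h2, h3⟩
  simp only [zetaTerm, term, power, Pi.smul_apply, smul_eq_mul, mul_assoc, ← Finset.mul_sum,
    neg_mul]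
  rfl

end Continuation

/-! ### Polynomials of equal degree and the product formula. -/

/-- The system of logarithms of finitely many polynomials of the same degree that satisfy
Mahler's Hypothesis. -/
noncomputable def mahlerSystem {p n d : ℕ} (hn : 0 < n) (f : Fin n → MvPolynomial (Fin p) ℂ)
    (hf : ∀ j, MahlerHypothesis (f j)) (hd : ∀ j, (f j).totalDegree = d)
    (ℓ : Fin n → (Fin p → ℝ) → ℂ) (hℓ : ∀ j, IsLogBranch (f j) (ℓ j)) : LogSystem p n where
  d := d
  D := n * d
  F := ∏ j, f j
  -- The logarithmic derivatives `∂ᵢfⱼ / fⱼ` are written over the common denominator `F`.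
  G j i := MvPolynomial.pderiv i (f j) * ∏ l ∈ Finset.univ.erase j, f l
  ℓ := ℓ
  d_pos := hd ⟨0, hn⟩ ▸ (hf ⟨0, hn⟩).nonconstant
  D_pos := Nat.mul_pos hn (hd ⟨0, hn⟩ ▸ (hf ⟨0, hn⟩).nonconstant)
  totalDegree_F := (MvPolynomial.totalDegree_finsetProd _ _).trans (by simp [hd])
  totalDegree_G j i := by
    have hd0 : 0 < d := hd ⟨0, hn⟩ ▸ (hf ⟨0, hn⟩).nonconstant
    refine (MvPolynomial.totalDegree_mul _ _).trans ((add_le_add (totalDegree_pderiv_le (f j) i)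
      (MvPolynomial.totalDegree_finsetProd _ _)).trans ?_)
    simp only [hd, Finset.sum_const, smul_eq_mul, Finset.card_erase_of_mem (Finset.mem_univ j),
      Finset.card_univ, Fintype.card_fin]
    obtain ⟨m, rfl⟩ := Nat.exists_eq_succ_of_ne_zero hn.ne'
    rw [Nat.succ_mul, Nat.succ_sub_one]
    omega
  totalDegree_euler j := by
    have hd0 : 0 < d := hd ⟨0, hn⟩ ▸ (hf ⟨0, hn⟩).nonconstant
    have h1 : ∑ i, MvPolynomial.X i * (MvPolynomial.pderiv i (f j) *
        ∏ l ∈ Finset.univ.erase j, f l) - (d : ℂ) • ∏ j, f j =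
        (∑ i, MvPolynomial.X i * MvPolynomial.pderiv i (f j) - (d : ℂ) • f j) *
          ∏ l ∈ Finset.univ.erase j, f l := by
      rw [← Finset.mul_prod_erase _ _ (Finset.mem_univ j), sub_mul, Finset.sum_mul,
        smul_mul_assoc]
      simp only [mul_assoc]
    rw [h1]
    refine (MvPolynomial.totalDegree_mul _ _).trans
      ((add_le_add (totalDegree_sum_X_mul_pderiv_sub_le (f j) (hd j).le)
        (MvPolynomial.totalDegree_finsetProd _ _)).trans ?_)
    simp only [hd, Finset.sum_const, smul_eq_mul, Finset.card_erase_of_mem (Finset.mem_univ j),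
      Finset.card_univ, Fintype.card_fin]
    obtain ⟨m, rfl⟩ := Nat.exists_eq_succ_of_ne_zero hn.ne'
    rw [Nat.succ_mul, Nat.succ_sub_one]
    omega
  exists_le_norm_F := by
    choose c hc h using fun j => (hf j).exists_le_norm
    refine ⟨∏ j, c j, Finset.prod_pos fun j _ => hc j, fun x hx => ?_⟩
    have : evalReal (∏ j, f j) x = ∏ j, evalReal (f j) x := by simp [evalReal]
    rw [this, norm_prod]
    calc (∏ j, c j) * (1 + ‖x‖) ^ (n * d) = ∏ j, c j * (1 + ‖x‖) ^ (f j).totalDegree := by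
          simp [Finset.prod_mul_distrib, hd, ← pow_mul, mul_comm n d]
      _ ≤ _ := Finset.prod_le_prod (fun j _ => by have := hc j; positivity) fun j _ => h j x hx
  exists_norm_sub_le := by
    choose C hC using fun j => (hf j).exists_norm_log_sub_le (hℓ j)
    refine ⟨∑ j, |C j|, fun j x hx => ?_⟩
    rw [← hd j]
    exact (hC j x hx).trans ((le_abs_self _).trans
      (Finset.single_le_sum (f := fun j => |C j|) (fun _ _ => abs_nonneg _) (Finset.mem_univ j)))
  hasDerivWithinAt j i x hx := by
    have h1 := hasDerivWithinAt_of_exp_eq (s := Set.Ici 0) (t₀ := x i)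
      (l := fun t => ℓ j (Function.update x i t))
      (φ := fun t => evalReal (f j) (Function.update x i t)) (hx i)
      (((hℓ j).continuousOn.comp (by fun_prop) fun t ht => update_mem_octant hx i ht) _ (hx i))
      (fun t ht => (hℓ j).exp_eq _ (update_mem_octant hx i ht))
      (hasDerivAt_evalReal_update (f j) x i).hasDerivWithinAt
    refine h1.congr_deriv ?_
    have h2 : evalReal (∏ l ∈ Finset.univ.erase j, f l) x ≠ 0 := by
      simp only [evalReal, map_prod]
      exact Finset.prod_ne_zero_iff.mpr fun l _ => (hf l).ne_zero x hx
    rw [Function.update_eq_self, ← Finset.mul_prod_erase _ _ (Finset.mem_univ j)]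
    simp only [evalReal, map_mul] at h2 ⊢
    rw [mul_div_mul_right _ _ h2]

theorem MahlerHypothesis.pos {p : ℕ} {f : MvPolynomial (Fin p) ℂ} (hf : MahlerHypothesis f) :
    0 < p := by
  rcases Nat.eq_zero_or_pos p with rfl | h
  · have := hf.nonconstant
    rw [MvPolynomial.eq_C_of_isEmpty f, MvPolynomial.totalDegree_C] at this
    exact absurd this (lt_irrefl 0)
  · exact h

theorem IsLogBranch.prod {p n : ℕ} {f : Fin n → MvPolynomial (Fin p) ℂ}
    {ℓ : Fin n → (Fin p → ℝ) → ℂ} (h : ∀ j, IsLogBranch (f j) (ℓ j)) :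
    IsLogBranch (∏ j, f j) fun x => ∑ j, ℓ j x where
  continuousOn := continuousOn_finsetSum _ fun j _ => (h j).continuousOn
  exp_eq x hx := by
    rw [Complex.exp_sum, evalReal, map_prod]
    exact Finset.prod_congr rfl fun j _ => (h j).exp_eq x hx

/-- Continuations for `ℓ` yield continuations for `N • ℓ + 2πim`. -/
theorem IsZetaContinuation.comp_mul {p N : ℕ} (hN : 0 < N) {g : MvPolynomial (Fin p) ℂ}
    {ℓ ℓ' : (Fin p → ℝ) → ℂ} {Z : ℂ → ℂ} (h : IsZetaContinuation g ℓ Z) (w : ℂ)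
    (hℓ : ∀ x ∈ octant p, ℓ' x = N * ℓ x + w) :
    IsZetaContinuation g ℓ' fun s => Complex.exp (-s * w) * Z (N * s) where
  meromorphicOn s _ := by
    refine MeromorphicAt.mul (AnalyticAt.meromorphicAt (by fun_prop)) ?_
    exact (h.meromorphicOn (N * s) trivial).comp_analyticAt (g := fun s => (N : ℂ) * s)
      (by fun_prop)
  hasSum := by
    obtain ⟨σ, hσ⟩ := h.hasSum
    have hN' : (0 : ℝ) < N := by exact_mod_cast hN
    refine ⟨σ / N, fun s hs => ?_⟩
    have h1 : σ < (N * s : ℂ).re := by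
      rw [div_lt_iff₀ hN'] at hs
      simpa [mul_comm] using hs
    refine ((hσ _ h1).mul_left (Complex.exp (-s * w))).congr_fun fun k => ?_
    rw [zetaTerm, zetaTerm, hℓ (fun i => (k i : ℝ)) (natPoint_mem_octant k), mul_left_comm, ← Complex.exp_add]
    congr 2
    ring

/-- With all `aⱼ = 1/n`, any branch for the product is `n` times the averaged branch plus a constant
`2πi m`. The continuation is `exp(-2πi m s) Z(n s)`, whose value at `0` is `Z 0`. -/
theorem exists_isZetaContinuation_prod {p n : ℕ} (hn : 0 < n)
    {f : Fin n → MvPolynomial (Fin p) ℂ} {g : MvPolynomial (Fin p) ℂ}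
    {ℓ : Fin n → (Fin p → ℝ) → ℂ} (hℓ : ∀ j, IsLogBranch (f j) (ℓ j)) {c : Fin n → ℂ}
    (hc : ∀ a : Fin n → ℂ, ∑ j, a j = 1 → ∃ Z : ℂ → ℂ,
      IsZetaContinuation g (fun x => ∑ j, a j * ℓ j x) Z ∧ AnalyticAt ℂ Z 0 ∧
      Z 0 = ∑ j, c j * a j) {ℓ' : (Fin p → ℝ) → ℂ} (hℓ' : IsLogBranch (∏ j, f j) ℓ') :
    ∃ Z : ℂ → ℂ, IsZetaContinuation g ℓ' Z ∧ AnalyticAt ℂ Z 0 ∧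
      Z 0 = (1 / (n : ℂ)) * ∑ j, c j := by
  have hn' : (n : ℂ) ≠ 0 := by exact_mod_cast hn.ne'
  obtain ⟨m, hm⟩ := exists_int_of_isLogBranch (.prod hℓ) hℓ'
  obtain ⟨Z, h1, h2, h3⟩ := hc (fun _ => 1 / n) (by simp [hn'])
  refine ⟨_, h1.comp_mul hn (m * (2 * Real.pi * Complex.I)) fun x hx => ?_, ?_, ?_⟩
  · rw [hm x hx, ← Finset.mul_sum, ← mul_assoc (n : ℂ), mul_one_div_cancel hn', one_mul]
  · refine AnalyticAt.mul (by fun_prop) ?_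
    exact AnalyticAt.fun_comp (g := Z) (by simpa using h2) (by fun_prop)
  · simp [h3, ← Finset.sum_mul, mul_comm]

theorem mainTheorem6 {p n : ℕ} (hn : 0 < n) (f : Fin n → MvPolynomial (Fin p) ℂ)
    (g : MvPolynomial (Fin p) ℂ) (hf : ∀ j, MahlerHypothesis (f j))
    (hdeg : ∀ i j, (f i).totalDegree = (f j).totalDegree) :
    (∀ j, ZetaRegularAt (f j) g 0) ∧
    ZetaRegularAt (∏ j, f j) g 0 ∧
    ∀ (v : Fin n → ℂ) (w : ℂ), (∀ j, IsZetaValue (f j) g 0 (v j)) →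
      IsZetaValue (∏ j, f j) g 0 w → w = (1 / (n : ℂ)) * ∑ j, v j := by
  have hp : 0 < p := (hf ⟨0, hn⟩).pos
  have hmain : ∀ ℓ : Fin n → (Fin p → ℝ) → ℂ, (∀ j, IsLogBranch (f j) (ℓ j)) →
      ∃ c : Fin n → ℂ, ∀ a : Fin n → ℂ, ∑ j, a j = 1 → ∃ Z : ℂ → ℂ,
        IsZetaContinuation g (fun x => ∑ j, a j * ℓ j x) Z ∧ AnalyticAt ℂ Z 0 ∧
        Z 0 = ∑ j, c j * a j := fun ℓ hℓ =>
    (mahlerSystem hn f hf (fun j => hdeg j ⟨0, hn⟩) ℓ hℓ).exists_isZetaContinuation hp g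
  have hsingle : ∀ (ℓ : Fin n → (Fin p → ℝ) → ℂ) (j : Fin n),
      (fun x => ∑ i, (Pi.single j 1 : Fin n → ℂ) i * ℓ i x) = ℓ j := fun ℓ j => by
    ext x
    simp [Pi.single_apply]
  choose ℓ₀ hℓ₀ using fun j => exists_isLogBranch (hf j).ne_zero
  refine ⟨fun j => ⟨⟨_, hℓ₀ j⟩, fun ℓ hℓ => ?_⟩, ⟨⟨_, .prod hℓ₀⟩, fun ℓ hℓ => ?_⟩, ?_⟩
  -- The prescribed branch is inserted at `j`, and the unit vector at `j` then selects it.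
  · obtain ⟨c, hc⟩ := hmain (Function.update ℓ₀ j ℓ) fun i => by
      rcases eq_or_ne i j with rfl | hi
      · simpa using hℓ
      · simpa [hi] using hℓ₀ i
    obtain ⟨Z, h1, h2, -⟩ := hc (Pi.single j 1) (by simp)
    rw [hsingle, Function.update_self] at h1
    exact ⟨Z, h1, h2⟩
  · obtain ⟨c, hc⟩ := hmain ℓ₀ hℓ₀
    obtain ⟨Z, h1, h2, -⟩ := exists_isZetaContinuation_prod hn hℓ₀ hc hℓ
    exact ⟨Z, h1, h2⟩
  · rintro v w hv ⟨ℓ', Z', hℓ', hZ', hZ'a, rfl⟩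
    choose ℓ Z hℓ hZ hZa hZv using hv
    obtain ⟨c, hc⟩ := hmain ℓ hℓ
    -- Evaluating the linear form at unit vectors identifies its coefficients, by uniqueness of the
    -- continuation.
    have hcv : ∀ j, v j = c j := by
      intro j
      obtain ⟨Y, h1, h2, h3⟩ := hc (Pi.single j 1) (by simp)
      rw [hsingle] at h1
      rw [← hZv j, (hZ j).apply_zero_unique h1 (hZa j) h2, h3]
      simp [Pi.single_apply]
    obtain ⟨Y, h1, h2, h3⟩ := exists_isZetaContinuation_prod hn hℓ hc hℓ'
    simp only [hcv]
    rw [← h3]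
    exact hZ'.apply_zero_unique h1 hZ'a h2
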